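/- Let $d\ge 1$, $Y=[0,2\pi)^d$, and let $A=(a_{jk})_{j,k=1}^d$ be a matrix of real, bounded, measurable functions on $\mathbb{R}^d$ which is symmetric, $Y$-periodic ($A(y+2\pi p)=A(y)$ for all $p\in\mathbb{Z}^d$ and a.e. $y$) and elliptic: there is $\alpha>0$ with $A(y)\xi\cdot\xi\ge\alpha|\xi|^2$ for all $\xi\in\mathbb{R}^d$ and a.e. $y$. Write $\mathcal{M}_Y(u)=\frac1{|Y|}\int_Y u\,dy$, let $\hat u(n)=\mathcal{M}_Y(u\,e^{-in\cdot y})$, and for $s\in\{1,2\}$ let $H^s_\sharp(Y)$ be the space of $Y$-periodic $u\in L^2_\sharp(Y)$ with $\|u\|_{H^s}=\big(\sum_{n\in\mathbb{Z}^d}(1+|n|^2)^s|\hat u(n)|^2\big)^{1/2}<\infty$. For $\rho\ge 1$ and $\eta\in\mathbb{R}^d$ consider the eigenvalue problem $$\mathcal{A}^\rho(\eta)\phi=\rho^2(\nabla+i\eta)^4\phi-(\nabla+i\eta)\cdot A(y)(\nabla+i\eta)\phi=\lambda\phi,\qquad \phi\in H^2_\sharp(Y)\setminus\{0\},$$ understood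 weakly: for all $v\in H^2_\sharp(Y)$, $$\int_Y A(\nabla+i\eta)\phi\cdot\overline{(\nabla+i\eta)v}\,dy+\rho^2\int_Y(\nabla+i\eta)^2\phi\,\overline{(\nabla+i\eta)^2v}\,dy=\lambda\int_Y\phi\,\overline{v}\,dy .$$ Let $\lambda_1^\rho(\eta)$ be the smallest eigenvalue and $\phi_1^\rho(\cdot;\eta)$ the corresponding eigenfunction normalized by $\mathcal{M}_Y(\phi_1^\rho(\cdot;\eta))=(2\pi)^{-d/2}$. For every $\rho\ge1$ these are well defined for $\eta$ in a neighbourhood of $0$ (the smallest eigenvalue exists and the normalized eigenfunction exists and is unique), and $\eta\mapsto\lambda_1^\rho(\eta)\in\mathbb{R}$ and $\eta\mapsto\phi_1^\rho(\cdot;\eta)\in H^2_\sharp(Y)$ are real analytic at $\eta=0$. For a multi-index $\beta\in\mathbb{N}_0^d$ write $\partial_0^\beta$ for the derivative $\partial_\eta^\beta$ evaluated at $\eta=0$, $|\beta|=\beta_1+\dots+\beta_d$, and $e_j$ for the $j$-th unit multi-index (and the $j$-th unit vector). Then, for all $1\le\rho<\infty$, where $a\lesssim b$ means $a\le Cb$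 with a constant $C$ that does not depend on $\rho$ (it may depend on $A$, $d$ and the order of differentiation): 1. $\|\partial_0^{e_j}\phi_1^\rho\|_{H^1}\lesssim\rho^{-2}$ and $\partial_0^{e_j}\lambda_1^\rho=0$ for all $j$; 2. $\|\partial_0^{e_j+e_k}\phi_1^\rho\|_{H^1}\lesssim\rho^{-2}$ and $\left|\tfrac12\partial_0^{e_j+e_k}\lambda_1^\rho-\mathcal{M}_Y(e_j\cdot Ae_k)\right|\lesssim\rho^{-2}$ for all $j,k$; 3. $\|\partial_0^{e_j+e_k+e_l}\phi_1^\rho\|_{H^1}\lesssim\rho^{-2}$ and $\partial_0^{e_j+e_k+e_l}\lambda_1^\rho=0$ for all $j,k,l$; 4. $\|\partial_0^{\beta}\phi_1^\rho\|_{H^1}\lesssim1$ for every $\beta$ with $|\beta|\ge4$; 5. $|\partial_0^\beta\lambda_1^\rho|\lesssim\rho^2$ for every $\beta$ with $|\beta|=4$, and $|\partial_0^\beta\lambda_1^\rho|\lesssim1$ for every $\beta$ with $|\beta|>4$. -/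

import Mathlib

open MeasureTheory Filter Topology
open scoped ENNReal ComplexConjugate

noncomputable section

namespace BlochWave

/-- The basic periodicity cell `Y = [0, 2π)^d`. -/
def cellY (d : ℕ) : Set (Fin d → ℝ) := Set.univ.pi fun _ => Set.Ico 0 (2 * Real.pi)

/-- Lebesgue measure on the cell. -/
abbrev muY (d : ℕ) : Measure (Fin d → ℝ) := (volume : Measure (Fin d → ℝ)).restrict (cellY d)

/-- `L²_♯(Y)`: a periodic function is given by its restriction to the cell. -/
abbrev L2Y (d : ℕ) : Type := Lp ℂ 2 (muY d)

/-- The character `e^{i n·y}`. -/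
def expY {d : ℕ} (n : Fin d → ℤ) (y : Fin d → ℝ) : ℂ :=
  Complex.exp (Complex.I * ∑ j, (n j : ℂ) * (y j : ℂ))

/-- The mean value `M_Y(f) = |Y|⁻¹ ∫_Y f`, with `|Y| = (2π)^d`. -/
def meanY {d : ℕ} {E : Type*} [NormedAddCommGroup E] [NormedSpace ℝ E]
    (f : (Fin d → ℝ) → E) : E :=
  ((2 * Real.pi) ^ d : ℝ)⁻¹ • ∫ y in cellY d, f y

/-- Fourier coefficient `û(n) = |Y|⁻¹ ∫_Y u(y) e^{-i n·y} dy`. -/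
def fourierY {d : ℕ} (u : L2Y d) (n : Fin d → ℤ) : ℂ :=
  meanY fun y => u y * conj (expY n y)

/-- The representative in `(0, 2π]` of `2π x`, for `x ∈ ℝ/ℤ`. -/
def unrollAux (x : UnitAddCircle) : ℝ := 2 * Real.pi * (AddCircle.equivIoc 1 0 x).1

theorem measurePreserving_unrollAux :
    MeasurePreserving unrollAux (volume : Measure UnitAddCircle)
      (ENNReal.ofReal (2 * Real.pi)⁻¹ • volume.restrict (Set.Ioc 0 (2 * Real.pi))) := by
  have hpi : (0 : ℝ) < 2 * Real.pi := by positivity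
  have h1 : MeasurePreserving (fun x : UnitAddCircle => (AddCircle.equivIoc 1 0 x).1) volume
      (volume.restrict (Set.Ioc (0 : ℝ) (0 + 1))) :=
    (measurePreserving_subtype_coe measurableSet_Ioc).comp
      (AddCircle.measurePreserving_equivIoc 1 (a := 0))
  have h2 : MeasurePreserving (fun t : ℝ => 2 * Real.pi * t)
      (volume.restrict (Set.Ioc (0 : ℝ) (0 + 1)))
      (ENNReal.ofReal (2 * Real.pi)⁻¹ • volume.restrict (Set.Ioc 0 (2 * Real.pi))) := by
    refine ⟨by fun_prop, ?_⟩
    have h3 := Real.map_volume_mul_left hpi.ne'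
    rw [abs_of_pos (inv_pos.2 hpi)] at h3
    rw [← Measure.restrict_smul, ← h3, Measure.restrict_map (by fun_prop) measurableSet_Ioc]
    congr 2
    ext t
    simp only [Set.mem_Ioc, Set.mem_preimage, zero_add]
    constructor
    · rintro ⟨a, b⟩; exact ⟨by positivity, by nlinarith⟩
    · rintro ⟨a, b⟩; exact ⟨by by_contra h; nlinarith, by nlinarith⟩
  exact h2.comp h1

/-- The parametrization of the cell by the unit torus. -/
def unroll {d : ℕ} (x : UnitAddTorus (Fin d)) : Fin d → ℝ := fun j => unrollAux (x j)

theorem measurePreserving_unroll (d : ℕ) :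
    MeasurePreserving (unroll (d := d))
      (Measure.pi fun _ : Fin d => (volume : Measure UnitAddCircle))
      (ENNReal.ofReal ((2 * Real.pi) ^ d)⁻¹ • muY d) := by
  have hpi : (0 : ℝ) < 2 * Real.pi := by positivity
  have hfin : IsFiniteMeasure (ENNReal.ofReal (2 * Real.pi)⁻¹ •
      (volume : Measure ℝ).restrict (Set.Ioc 0 (2 * Real.pi))) :=
    Measure.smul_finite _ ENNReal.ofReal_ne_top
  have h := measurePreserving_pi (fun _ : Fin d => (volume : Measure UnitAddCircle))
    (fun _ => ENNReal.ofReal (2 * Real.pi)⁻¹ • volume.restrict (Set.Ioc 0 (2 * Real.pi)))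
    (fun _ => measurePreserving_unrollAux)
  convert! h using 1
  symm
  refine Measure.pi_eq fun s hs => ?_
  have : muY d = Measure.pi fun _ : Fin d => (volume : Measure ℝ).restrict
      (Set.Ico 0 (2 * Real.pi)) := Measure.restrict_pi_pi _ _
  rw [Measure.smul_apply, this, Measure.pi_pi]
  simp only [Measure.smul_apply, smul_eq_mul, Finset.prod_mul_distrib, Finset.prod_const,
    Finset.card_univ, Fintype.card_fin]
  rw [← inv_pow, ENNReal.ofReal_pow (by positivity)]
  congr 1
  refine Finset.prod_congr rfl fun j _ => ?_
  rw [Measure.restrict_congr_set (Ico_ae_eq_Ioc)]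

theorem mFourier_eq_unroll {d : ℕ} (n : Fin d → ℤ) (x : UnitAddTorus (Fin d)) :
    UnitAddTorus.mFourier n x = expY n (unroll x) := by
  have h1 : ∀ z : UnitAddCircle, ((AddCircle.equivIoc 1 0 z).1 : UnitAddCircle) = z := fun z =>
    (AddCircle.equivIoc (1 : ℝ) 0).symm_apply_apply z
  have h2 : UnitAddTorus.mFourier n x = ∏ j, fourier (n j) (x j) := rfl
  rw [h2, expY, Finset.mul_sum, Complex.exp_sum]
  refine Finset.prod_congr rfl fun j _ => ?_
  conv_lhs => rw [← h1 (x j)]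
  rw [fourier_coe_apply]
  simp only [unroll, unrollAux]
  push_cast
  congr 1
  ring

/-- Parseval's identity on the cell. -/
theorem hasSum_sq_fourierY {d : ℕ} (u : L2Y d) :
    HasSum (fun n => ‖fourierY u n‖ ^ 2) (meanY fun y => ‖u y‖ ^ 2) := by
  have hpi : (0 : ℝ) < (2 * Real.pi) ^ d := by positivity
  have hm := measurePreserving_unroll d
  have hμ : (Measure.pi fun _ : Fin d => (volume : Measure UnitAddCircle)) =
      Measure.pi fun _ : Fin d => (AddCircle.haarAddCircle : Measure UnitAddCircle) := by
    simp [AddCircle.volume_eq_smul_haarAddCircle]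
  rw [hμ] at hm
  have hint : ∀ {E : Type} [NormedAddCommGroup E] [NormedSpace ℝ E] (F : (Fin d → ℝ) → E),
      AEStronglyMeasurable F (muY d) →
      ∫ x, F (unroll x) ∂(Measure.pi fun _ : Fin d =>
        (AddCircle.haarAddCircle : Measure UnitAddCircle)) = meanY F := by
    intro E _ _ F hF
    rw [← integral_map hm.measurable.aemeasurable (by
      rw [hm.map_eq]; exact hF.mono_ac Measure.smul_absolutelyContinuous), hm.map_eq,
      integral_smul_measure, ENNReal.toReal_ofReal (by positivity)]
    rfl
  have hu : MemLp (u : (Fin d → ℝ) → ℂ) 2 (ENNReal.ofReal ((2 * Real.pi) ^ d)⁻¹ • muY d) :=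
    (Lp.memLp u).smul_measure ENNReal.ofReal_ne_top
  have hg := hu.comp_measurePreserving hm
  have hP := UnitAddTorus.hasSum_sq_mFourierCoeff (d := Fin d) (hg.toLp _)
  have hco := hg.coeFn_toLp
  have hmeas := (Lp.aestronglyMeasurable u)
  have hexp : ∀ n : Fin d → ℤ, Continuous (expY n) := fun n => by unfold expY; fun_prop
  convert! hP using 1
  · funext n
    congr 2
    unfold fourierY UnitAddTorus.mFourierCoeff
    have hE : AEStronglyMeasurable (fun y => u y * conj (expY n y)) (muY d) :=
      hmeas.mul (Complex.continuous_conj.comp (hexp n)).aestronglyMeasurable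
    rw [← hint _ hE]
    refine integral_congr_ae ?_
    filter_upwards [hco] with x hx
    rw [hx, UnitAddTorus.mFourier_neg, mFourier_eq_unroll, smul_eq_mul, mul_comm]
    rfl
  · rw [← hint _ (by fun_prop)]
    refine integral_congr_ae ?_
    filter_upwards [hco] with x hx
    rw [hx]
    rfl

theorem integrableOn_mul_expY {d : ℕ} (u : L2Y d) (n : Fin d → ℤ) :
    IntegrableOn (fun y => u y * conj (expY n y)) (cellY d) := by
  have hfin : IsFiniteMeasure (muY d) := by
    refine ⟨?_⟩
    rw [Measure.restrict_apply_univ, cellY, volume_pi_pi]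
    exact ENNReal.prod_lt_top fun j _ => by
      rw [Real.volume_Ico]
      exact ENNReal.ofReal_lt_top
  have h1 : Integrable (u : (Fin d → ℝ) → ℂ) (muY d) := (Lp.memLp u).integrable (by norm_num)
  have hexp : Continuous (expY n) := by unfold expY; fun_prop
  refine h1.mul_bdd (c := 1) (Complex.continuous_conj.comp hexp).aestronglyMeasurable ?_
  refine Filter.Eventually.of_forall fun y => ?_
  simp [expY, Complex.norm_exp]

theorem fourierY_add {d : ℕ} (u v : L2Y d) (n : Fin d → ℤ) :
    fourierY (u + v) n = fourierY u n + fourierY v n := by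
  unfold fourierY meanY
  rw [← smul_add, ← integral_add (integrableOn_mul_expY u n) (integrableOn_mul_expY v n)]
  congr 1
  refine integral_congr_ae ?_
  filter_upwards [Lp.coeFn_add u v] with y hy
  rw [hy, Pi.add_apply, add_mul]

theorem fourierY_smul {d : ℕ} (c : ℂ) (u : L2Y d) (n : Fin d → ℤ) :
    fourierY (c • u) n = c * fourierY u n := by
  unfold fourierY meanY
  rw [mul_smul_comm, ← integral_const_mul]
  congr 1
  refine integral_congr_ae ?_
  filter_upwards [Lp.coeFn_smul c u] with y hy
  rw [hy, Pi.smul_apply, smul_eq_mul, mul_assoc]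

theorem eq_zero_of_fourierY {d : ℕ} (u : L2Y d) (h : ∀ n, fourierY u n = 0) : u = 0 := by
  have hpi : (0 : ℝ) < (2 * Real.pi) ^ d := by positivity
  have h1 := hasSum_sq_fourierY u
  simp only [h, norm_zero, ne_eq, OfNat.ofNat_ne_zero, not_false_eq_true, zero_pow] at h1
  have h2 := h1.unique hasSum_zero
  unfold meanY at h2
  rw [smul_eq_mul, mul_eq_zero, or_iff_right (inv_pos.2 hpi).ne',
    integral_eq_zero_iff_of_nonneg (fun _ => by positivity)
      ((memLp_two_iff_integrable_sq_norm (Lp.aestronglyMeasurable u)).1 (Lp.memLp u))] at h2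
  refine (Lp.eq_zero_iff_ae_eq_zero).2 ?_
  filter_upwards [h2] with y hy
  simpa using hy

/-- The weight `(1 + |n|²)^s`. -/
def sobolevWeight {d : ℕ} (s : ℕ) (n : Fin d → ℤ) : ℝ := (1 + ∑ j, (n j : ℝ) ^ 2) ^ s

theorem sobolevWeight_pos {d : ℕ} (s : ℕ) (n : Fin d → ℤ) : 0 < sobolevWeight s n := by
  unfold sobolevWeight; positivity

/-- The norm `(∑ₙ (1 + |n|²)^s |û(n)|²)^{1/2}` of `H^s_♯(Y)`. -/
def sobolevNorm {d : ℕ} (s : ℕ) (u : L2Y d) : ℝ :=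
  √(∑' n, sobolevWeight s n * ‖fourierY u n‖ ^ 2)

/-- `H^s_♯(Y)` as a subspace of `L²_♯(Y)`: the functions with finite `H^s` norm. -/
def sobolevSubmodule (d s : ℕ) : Submodule ℂ (L2Y d) where
  carrier := {u | Summable fun n => sobolevWeight s n * ‖fourierY u n‖ ^ 2}
  zero_mem' := by
    have h (n : Fin d → ℤ) : fourierY (0 : L2Y d) n = 0 := by
      simpa using fourierY_smul (0 : ℂ) (0 : L2Y d) n
    simp [h]
  add_mem' := by
    intro u v hu hv
    simp only [Set.mem_ofPred_eq] at hu hv ⊢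
    refine Summable.of_nonneg_of_le
      (fun n => mul_nonneg (sobolevWeight_pos s n).le (by positivity)) (fun n => ?_)
      ((hu.add hv).mul_left 2)
    rw [fourierY_add, ← mul_add, mul_left_comm]
    refine mul_le_mul_of_nonneg_left ?_ (sobolevWeight_pos s n).le
    have h1 := norm_add_le (fourierY u n) (fourierY v n)
    have h2 := norm_nonneg (fourierY u n + fourierY v n)
    nlinarith [sq_nonneg (‖fourierY u n‖ - ‖fourierY v n‖)]
  smul_mem' := by
    intro c u hu
    simp only [Set.mem_ofPred_eq] at hu ⊢
    refine (hu.mul_left (‖c‖ ^ 2)).congr fun n => ?_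
    rw [fourierY_smul, norm_mul]
    ring

/-- The space `H^s_♯(Y)`, carrying its own norm (not that of `L²`). -/
def HY (d s : ℕ) : Type := sobolevSubmodule d s

instance (d s : ℕ) : AddCommGroup (HY d s) := inferInstanceAs (AddCommGroup (sobolevSubmodule d s))

instance (d s : ℕ) : Module ℂ (HY d s) := inferInstanceAs (Module ℂ (sobolevSubmodule d s))

/-- The inclusion `H^s_♯(Y) ⊆ L²_♯(Y)`. -/
def HY.toL2 {d s : ℕ} : HY d s →ₗ[ℂ] L2Y d := (sobolevSubmodule d s).subtype

/-- The sequence of weighted Fourier coefficients of `u ∈ H^s_♯(Y)`. -/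
def HY.toSeq {d s : ℕ} : HY d s →ₗ[ℂ] lp (fun _ : Fin d → ℤ => ℂ) 2 where
  toFun u := ⟨fun n => (√(sobolevWeight s n) : ℂ) * fourierY (HY.toL2 u) n, by
    refine memℓp_gen ?_
    have hu : Summable fun n => sobolevWeight s n * ‖fourierY (HY.toL2 u) n‖ ^ 2 := u.2
    refine hu.congr fun n => ?_
    simp [mul_pow, Real.sq_sqrt (sobolevWeight_pos s n).le]⟩
  map_add' u v := by
    ext n
    simp only [map_add, fourierY_add, mul_add]
    rfl
  map_smul' c u := by
    ext n
    simp [fourierY_smul, mul_left_comm]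

theorem HY.toSeq_injective {d s : ℕ} : Function.Injective (HY.toSeq (d := d) (s := s)) := by
  refine (injective_iff_map_eq_zero _).2 fun u hu => ?_
  have h1 : HY.toL2 u = 0 := eq_zero_of_fourierY _ fun n => by
    have h2 : (√(sobolevWeight s n) : ℂ) * fourierY (HY.toL2 u) n = 0 :=
      congrFun (congrArg Subtype.val hu) n
    refine (mul_eq_zero.1 h2).resolve_left ?_
    exact_mod_cast (Real.sqrt_pos.2 (sobolevWeight_pos s n)).ne'
  exact Subtype.ext h1

instance (d s : ℕ) : NormedAddCommGroup (HY d s) :=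
  NormedAddCommGroup.induced (HY d s) (lp (fun _ : Fin d → ℤ => ℂ) 2) HY.toSeq HY.toSeq_injective

instance (d s : ℕ) : NormedSpace ℂ (HY d s) :=
  NormedSpace.induced ℂ (HY d s) (lp (fun _ : Fin d → ℤ => ℂ) 2) HY.toSeq

theorem HY.norm_eq {d s : ℕ} (u : HY d s) : ‖u‖ = sobolevNorm s (HY.toL2 u) := by
  have h1 : ‖u‖ = ‖HY.toSeq u‖ := rfl
  have h2 := lp.norm_rpow_eq_tsum (p := 2) (by norm_num) (HY.toSeq u)
  rw [h1, sobolevNorm, eq_comm, Real.sqrt_eq_iff_eq_sq (tsum_nonneg fun n =>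
    mul_nonneg (sobolevWeight_pos s n).le (by positivity)) (norm_nonneg _)]
  simp only [ENNReal.toReal_ofNat, Real.rpow_ofNat] at h2
  rw [h2]
  refine tsum_congr fun n => ?_
  have h3 : (HY.toSeq u) n = (√(sobolevWeight s n) : ℂ) * fourierY (HY.toL2 u) n := rfl
  rw [h3]
  simp [mul_pow, Real.sq_sqrt (sobolevWeight_pos s n).le]

open Classical in
/-- The periodic distributional derivative `∂u/∂y_j`: the function `g ∈ L²_♯(Y)` with
`ĝ(n) = i n_j û(n)` for all `n`, if there is one (it is then unique), and `0` otherwise. -/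
def pderivY {d : ℕ} (j : Fin d) (u : L2Y d) : L2Y d :=
  if h : ∃ g : L2Y d, ∀ n, fourierY g n = Complex.I * (n j : ℂ) * fourierY u n then h.choose else 0

/-- The `j`-th component of `(∇ + iη)u`. -/
def shiftGrad {d : ℕ} (η : Fin d → ℝ) (j : Fin d) (u : L2Y d) : L2Y d :=
  pderivY j u + (Complex.I * (η j : ℂ)) • u

/-- `(∇ + iη)²u = (∇ + iη)·(∇ + iη)u`. -/
def shiftLaplacian {d : ℕ} (η : Fin d → ℝ) (u : L2Y d) : L2Y d :=
  ∑ j, shiftGrad η j (shiftGrad η j u)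

/-- The standing assumptions on the coefficient matrix: real, bounded, measurable entries;
uniform ellipticity; `Y`-periodicity; symmetry. -/
structure IsPeriodicElliptic {d : ℕ} (A : (Fin d → ℝ) → Matrix (Fin d) (Fin d) ℝ) : Prop where
  measurable : ∀ j k, Measurable fun y => A y j k
  bounded : ∃ M : ℝ, ∀ j k, ∀ᵐ y, |A y j k| ≤ M
  elliptic : ∃ α : ℝ, 0 < α ∧ ∀ᵐ y, ∀ ξ : Fin d → ℝ,
    α * ∑ j, ξ j ^ 2 ≤ ∑ j, (∑ k, A y j k * ξ k) * ξ j
  periodic : ∀ p : Fin d → ℤ, ∀ᵐ y, A (fun j => y j + 2 * Real.pi * p j) = A y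
  symm : ∀ᵐ y, (A y).IsSymm

/-- The form `a^ρ[η](u,v) = ∫_Y A(∇+iη)u·conj((∇+iη)v) + ρ² ∫_Y (∇+iη)²u conj((∇+iη)²v)`. -/
def blochForm {d : ℕ} (A : (Fin d → ℝ) → Matrix (Fin d) (Fin d) ℝ) (ρ : ℝ) (η : Fin d → ℝ)
    (u v : L2Y d) : ℂ :=
  (∫ y in cellY d, ∑ j, (∑ k, (A y j k : ℂ) * shiftGrad η k u y) * conj (shiftGrad η j v y)) +
    (ρ : ℂ) ^ 2 * ∫ y in cellY d, shiftLaplacian η u y * conj (shiftLaplacian η v y)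

/-- `φ ∈ H²_♯(Y)` is an eigenfunction, with eigenvalue `lam`, of the shifted operator
`A^ρ(η) = ρ²(∇+iη)⁴ - (∇+iη)·A(∇+iη)` (the operator of the form `a^ρ[η]`). -/
def IsBlochEigenfunction {d : ℕ} (A : (Fin d → ℝ) → Matrix (Fin d) (Fin d) ℝ) (ρ : ℝ)
    (η : Fin d → ℝ) (lam : ℝ) (φ : HY d 2) : Prop :=
  φ ≠ 0 ∧ ∀ v : HY d 2, blochForm A ρ η (HY.toL2 φ) (HY.toL2 v) =
    (lam : ℂ) * ∫ y in cellY d, HY.toL2 φ y * conj (HY.toL2 v y)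

/-- The set of Bloch eigenvalues at `η`. -/
def blochEigenvalues {d : ℕ} (A : (Fin d → ℝ) → Matrix (Fin d) (Fin d) ℝ) (ρ : ℝ)
    (η : Fin d → ℝ) : Set ℝ :=
  {lam | ∃ φ, IsBlochEigenfunction A ρ η lam φ}

/-- The first Bloch eigenvalue `λ₁^ρ(η)`. -/
def firstEigenvalue {d : ℕ} (A : (Fin d → ℝ) → Matrix (Fin d) (Fin d) ℝ) (ρ : ℝ)
    (η : Fin d → ℝ) : ℝ :=
  sInf (blochEigenvalues A ρ η)

/-- `φ` is an eigenfunction for the first Bloch eigenvalue, normalized by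
`M_Y(φ) = (2π)^{-d/2}`. -/
def IsNormalizedGroundState {d : ℕ} (A : (Fin d → ℝ) → Matrix (Fin d) (Fin d) ℝ) (ρ : ℝ)
    (η : Fin d → ℝ) (φ : HY d 2) : Prop :=
  IsBlochEigenfunction A ρ η (firstEigenvalue A ρ η) φ ∧
    meanY (HY.toL2 φ : (Fin d → ℝ) → ℂ) = (((2 * Real.pi) ^ (-(d : ℝ) / 2) : ℝ) : ℂ)

open Classical in
/-- The first Bloch eigenfunction `φ₁^ρ(·;η)`, normalized by its mean value (and `0` at the `η`,
away from the origin, where no such normalization is possible). -/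
def firstEigenfunction {d : ℕ} (A : (Fin d → ℝ) → Matrix (Fin d) (Fin d) ℝ) (ρ : ℝ)
    (η : Fin d → ℝ) : HY d 2 :=
  if h : ∃ φ, IsNormalizedGroundState A ρ η φ then h.choose else 0

/-- The partial derivative `∂f/∂η_j`. -/
def partialEta {d : ℕ} {E : Type*} [NormedAddCommGroup E] [NormedSpace ℝ E] (j : Fin d)
    (f : (Fin d → ℝ) → E) : (Fin d → ℝ) → E :=
  fun η => fderiv ℝ f η (Pi.single j 1)

/-- `∂^β f = ∂^{β_1}/∂η_1^{β_1} ⋯ ∂^{β_d}/∂η_d^{β_d} f` for a multi-index `β`. -/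
def multiPartial {d : ℕ} {E : Type*} [NormedAddCommGroup E] [NormedSpace ℝ E] (β : Fin d → ℕ)
    (f : (Fin d → ℝ) → E) : (Fin d → ℝ) → E :=
  (List.finRange d).foldr (fun j g => (partialEta j)^[β j] g) f

/-- `‖∂^β φ₁^ρ|_{η=0}‖_{H¹}`. -/
def eigenfunctionDerivNorm {d : ℕ} (A : (Fin d → ℝ) → Matrix (Fin d) (Fin d) ℝ) (ρ : ℝ)
    (β : Fin d → ℕ) : ℝ :=
  sobolevNorm 1 (HY.toL2 (multiPartial β (firstEigenfunction A ρ) 0))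

/-- `∂^β λ₁^ρ|_{η=0}`. -/
def eigenvalueDeriv {d : ℕ} (A : (Fin d → ℝ) → Matrix (Fin d) (Fin d) ℝ) (ρ : ℝ)
    (β : Fin d → ℕ) : ℝ :=
  multiPartial β (firstEigenvalue A ρ) 0

/-- The multi-index `e_j`. -/
def unitIndex {d : ℕ} (j : Fin d) : Fin d → ℕ := Pi.single j 1

end BlochWave

end

/-! Put `ε = ρ⁻² ∈ (0, 1]` and look for the ground state in the form `e + ε χ`, with `e` the
constant function and `χ` of mean value zero. Testing the weak equation with `e` determines the
eigenvalue: `λ = ρ² μ`, where `μ = |η|⁴ + ε ‖e‖⁻² ∑ⱼ ⟪i ηⱼ e, fluxⱼ⟫` and `flux = A(i η e + ε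
(∇+iη)χ)`. When a mean-zero `v` is the test function, `(∇+iη)²v` is orthogonal to `e` and all powers
of `ρ` cancel. What is left is `(∇+iη)⁴χ - (∇+iη)·flux = μ χ` on mean-zero functions, an equation
that is analytic in `(η, ε, χ)` also across `ε = 0`. The singular limit `ρ → ∞` has thus become a
regular one.

At `η = 0` this equation is linear, with operator `Δ² - ε ∇·A∇`. For `ε ≥ 0` it is coercive on
mean-zero functions, because `Δ` is bounded below there and `A` is nonnegative. The implicit
function theorem (`exists_branch`) therefore yields a solution `h(η, ε)`, analytic near `(0, ε₀)`
for each `ε₀ ∈ [0, 1]`. The full form is bounded below on mean-zero functions (`exists_coercive`),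
whereas the eigenvalue of the branch tends to `0` with `η`; hence the branch is the ground state,
and it is simple (`exists_smul_of_isEigenvector`, `isLeast`).

Consequently `φ₁ = c (e + ε h(η, ε))` and `λ₁ = ρ² |η|⁴ + M_Y(A)η·η + ε r(η, ε)` near `η = 0`, with
`h` and `r` jointly analytic. Their `η`-derivatives at `0` are bounded locally in `ε`, hence on the
compact interval `[0, 1]`, which makes the constants independent of `ρ`. Every derivative of `φ₁` of
positive order is `O(ρ⁻²)`, and those of `λ₁` agree up to `O(ρ⁻²)` with the derivatives of two
homogeneous polynomials, of degrees 4 and 2. Derivatives of `λ₁` of odd order vanish because complex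
conjugation exchanges the problems at `η` and `-η`. -/

/-! ### The abstract corrector equation. -/

section
open scoped ContDiff
namespace BlochWave

/-- The operators entering the form of a fourth order Bloch problem: the inclusion, the partial
derivatives, the Laplacian, and multiplication by the coefficients. -/
structure FormData (d : ℕ) (W K : Type*) [NormedAddCommGroup W] [InnerProductSpace ℂ W]
    [NormedAddCommGroup K] [InnerProductSpace ℂ K] where
  incl : W →L[ℂ] K
  grad : Fin d → W →L[ℂ] K
  lap : W →L[ℂ] K
  coef : Fin d → Fin d → K →L[ℂ] K

namespace FormData

variable {d : ℕ} {W K : Type*} [NormedAddCommGroup W] [InnerProductSpace ℂ W]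
    [NormedAddCommGroup K] [InnerProductSpace ℂ K] (F : FormData d W K)

local notation "⟪" x ", " y "⟫" => inner ℂ x y

/-- The `j`-th component of the shifted gradient. -/
noncomputable def gradOp (η : Fin d → ℝ) (j : Fin d) : W →L[ℂ] K :=
  F.grad j + (Complex.I * (η j : ℂ)) • F.incl

/-- The shifted Laplacian. -/
noncomputable def lapOp (η : Fin d → ℝ) : W →L[ℂ] K :=
  F.lap + ∑ j, (2 * Complex.I * (η j : ℂ)) • F.grad j - (∑ j, (η j : ℂ) ^ 2) • F.incl

/-- The sesquilinear form of the shifted fourth order operator. -/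
noncomputable def form (ρ : ℝ) (η : Fin d → ℝ) (u v : W) : ℂ :=
  ∑ j, ⟪F.gradOp η j v, ∑ k, F.coef j k (F.gradOp η k u)⟫ +
    (ρ : ℂ) ^ 2 * ⟪F.lapOp η v, F.lapOp η u⟫

/-- Restriction of the operators to a subspace. -/
noncomputable def restrict (X : Submodule ℂ W) : FormData d X K where
  incl := F.incl ∘L X.subtypeL
  grad j := F.grad j ∘L X.subtypeL
  lap := F.lap ∘L X.subtypeL
  coef := F.coef

@[simp]
theorem gradOp_restrict (X : Submodule ℂ W) (η : Fin d → ℝ) (j : Fin d) (x : X) :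
    (F.restrict X).gradOp η j x = F.gradOp η j x := by
  simp [gradOp, restrict]

@[simp]
theorem lapOp_restrict (X : Submodule ℂ W) (η : Fin d → ℝ) (x : X) :
    (F.restrict X).lapOp η x = F.lapOp η x := by
  simp [lapOp, restrict]

/-- The flux of the corrected constant `o + ε χ`, divided by its natural scale. -/
noncomputable def flux (o : K) (η : Fin d → ℝ) (ε : ℝ) (χ : W) (j : Fin d) : K :=
  ∑ k, F.coef j k ((Complex.I * (η k : ℂ)) • o + (ε : ℂ) • F.gradOp η k χ)

/-- The rescaled eigenvalue belonging to the corrector `χ`. -/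
noncomputable def scaledEigenvalue (o : K) (η : Fin d → ℝ) (ε : ℝ) (χ : W) : ℂ :=
  (∑ j, (η j : ℂ) ^ 2) ^ 2 +
    ((ε / ‖o‖ ^ 2 : ℝ) : ℂ) * ∑ j, ⟪(Complex.I * (η j : ℂ)) • o, F.flux o η ε χ j⟫

theorem contDiff_gradOp (j : Fin d) : ContDiff ℝ ω fun η : Fin d → ℝ => F.gradOp η j := by
  unfold gradOp
  have := Complex.ofRealCLM.contDiff (n := ω)
  have h (j : Fin d) : ContDiff ℝ ω fun η : Fin d → ℝ => (η j : ℂ) :=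
    this.comp (contDiff_apply _ _ j)
  fun_prop

theorem contDiff_lapOp : ContDiff ℝ ω F.lapOp := by
  unfold lapOp
  have := Complex.ofRealCLM.contDiff (n := ω)
  have h (j : Fin d) : ContDiff ℝ ω fun η : Fin d → ℝ => (η j : ℂ) :=
    this.comp (contDiff_apply _ _ j)
  fun_prop

/-- Operators and vectors are complex while the parameters `η`, `ε` are real, so smoothness is over
`ℝ` throughout; smoothness of order `ω` is analyticity. -/
theorem contDiff_clm_apply {E : Type*} [NormedAddCommGroup E] [NormedSpace ℝ E]
    {U V : Type*} [NormedAddCommGroup U] [NormedSpace ℂ U] [NormedAddCommGroup V] [NormedSpace ℂ V]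
    {f : E → U →L[ℂ] V} {g : E → U} (hf : ContDiff ℝ ω f) (hg : ContDiff ℝ ω g) :
    ContDiff ℝ ω fun x => f x (g x) := by
  have h := ((ContinuousLinearMap.restrictScalarsL ℂ U V ℝ ℝ).contDiff (n := ω)).comp hf
  exact h.clm_apply hg

theorem contDiff_flux (o : K) (j : Fin d) :
    ContDiff ℝ ω fun p : ((Fin d → ℝ) × ℝ) × W => F.flux o p.1.1 p.1.2 p.2 j := by
  unfold flux
  have hc := Complex.ofRealCLM.contDiff (n := ω)
  refine ContDiff.sum fun k _ => contDiff_clm_apply contDiff_const ?_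
  have h1 : ContDiff ℝ ω fun p : ((Fin d → ℝ) × ℝ) × W => (p.1.1 k : ℂ) :=
    hc.comp (f := fun p : ((Fin d → ℝ) × ℝ) × W => p.1.1 k) (by fun_prop)
  have h2 : ContDiff ℝ ω fun p : ((Fin d → ℝ) × ℝ) × W => (p.1.2 : ℂ) :=
    hc.comp (f := fun p : ((Fin d → ℝ) × ℝ) × W => p.1.2) (by fun_prop)
  have h3 : ContDiff ℝ ω fun p : ((Fin d → ℝ) × ℝ) × W => F.gradOp p.1.1 k p.2 :=
    contDiff_clm_apply ((F.contDiff_gradOp k).comp (contDiff_fst.comp contDiff_fst)) contDiff_snd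
  fun_prop

theorem contDiff_inner_flux (o : K) :
    ContDiff ℝ ω fun p : ((Fin d → ℝ) × ℝ) × W =>
      ∑ j, ⟪(Complex.I * (p.1.1 j : ℂ)) • o, F.flux o p.1.1 p.1.2 p.2 j⟫ := by
  have hc := Complex.ofRealCLM.contDiff (n := ω)
  refine ContDiff.sum fun j _ => ?_
  have h1 : ContDiff ℝ ω fun p : ((Fin d → ℝ) × ℝ) × W => (p.1.1 j : ℂ) :=
    hc.comp (f := fun p : ((Fin d → ℝ) × ℝ) × W => p.1.1 j) (by fun_prop)
  have h2 := F.contDiff_flux o j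
  refine ContDiff.inner ℂ ?_ h2
  fun_prop

theorem contDiff_scaledEigenvalue (o : K) :
    ContDiff ℝ ω fun p : ((Fin d → ℝ) × ℝ) × W => F.scaledEigenvalue o p.1.1 p.1.2 p.2 := by
  unfold scaledEigenvalue
  have hc := Complex.ofRealCLM.contDiff (n := ω)
  have h1 (j) : ContDiff ℝ ω fun p : ((Fin d → ℝ) × ℝ) × W => (p.1.1 j : ℂ) :=
    hc.comp (f := fun p : ((Fin d → ℝ) × ℝ) × W => p.1.1 j) (by fun_prop)
  have h2 := F.contDiff_inner_flux o
  have h3 : ContDiff ℝ ω fun p : ((Fin d → ℝ) × ℝ) × W => ((p.1.2 / ‖o‖ ^ 2 : ℝ) : ℂ) :=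
    ContDiff.comp (g := fun x : ℝ => (x : ℂ)) (f := fun p : ((Fin d → ℝ) × ℝ) × W =>
      p.1.2 / ‖o‖ ^ 2) hc (by fun_prop)
  exact (by fun_prop : ContDiff ℝ ω fun p : ((Fin d → ℝ) × ℝ) × W =>
    (∑ j, (p.1.1 j : ℂ) ^ 2) ^ 2).add (h3.mul h2)

section Residual

variable [CompleteSpace W] [CompleteSpace K]

open ContinuousLinearMap (adjoint)

/-- The residual of the rescaled corrector equation, with the eigenvalue eliminated. -/
noncomputable def residual (o : K) (η : Fin d → ℝ) (ε : ℝ) (χ : W) : W :=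
  adjoint (F.lapOp η) (F.lapOp η χ) + ∑ j, adjoint (F.gradOp η j) (F.flux o η ε χ j) -
    F.scaledEigenvalue o η ε χ • adjoint F.incl (F.incl χ)

theorem inner_residual (o : K) (η : Fin d → ℝ) (ε : ℝ) (χ v : W) :
    ⟪v, F.residual o η ε χ⟫ = ⟪F.lapOp η v, F.lapOp η χ⟫ +
      ∑ j, ⟪F.gradOp η j v, F.flux o η ε χ j⟫ -
      F.scaledEigenvalue o η ε χ * ⟪F.incl v, F.incl χ⟫ := by
  simp [residual, ContinuousLinearMap.adjoint_inner_right]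

/-- Conjugate-linear over `ℂ`, the adjoint is bounded and linear over `ℝ`, hence real analytic. -/
theorem contDiff_adjoint :
    ContDiff ℝ ω fun T : W →L[ℂ] K => adjoint T := by
  refine IsBoundedLinearMap.contDiff (𝕜 := ℝ) ⟨⟨fun x y => map_add _ x y, fun c x => ?_⟩,
    ⟨1, one_pos, fun x => by simp⟩⟩
  have : c • x = (c : ℂ) • x := rfl
  rw [this, map_smulₛₗ]
  simp

theorem contDiff_residual (o : K) :
    ContDiff ℝ ω fun p : ((Fin d → ℝ) × ℝ) × W => F.residual o p.1.1 p.1.2 p.2 := by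
  unfold residual
  have hη : ContDiff ℝ ω fun p : ((Fin d → ℝ) × ℝ) × W => p.1.1 := by fun_prop
  have hL : ContDiff ℝ ω fun p : ((Fin d → ℝ) × ℝ) × W => F.lapOp p.1.1 :=
    F.contDiff_lapOp.comp hη
  have h1 := contDiff_clm_apply (contDiff_adjoint.comp hL) (contDiff_clm_apply hL contDiff_snd)
  have h2 := ContDiff.sum (s := Finset.univ) fun j (_ : j ∈ Finset.univ) =>
    contDiff_clm_apply (contDiff_adjoint.comp ((F.contDiff_gradOp j).comp hη)) (F.contDiff_flux o j)
  have h3 : ContDiff ℝ ω fun p : ((Fin d → ℝ) × ℝ) × W => adjoint F.incl (F.incl p.2) :=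
    contDiff_clm_apply contDiff_const (contDiff_clm_apply contDiff_const contDiff_snd)
  exact (h1.add h2).sub ((F.contDiff_scaledEigenvalue o).smul h3)

/-- The linearization of the residual at the origin. -/
noncomputable def linearization (ε : ℝ) : W →L[ℂ] W :=
  adjoint F.lap ∘L F.lap +
    ∑ j, adjoint (F.grad j) ∘L ∑ k, (ε : ℂ) • (F.coef j k ∘L F.grad k)

/-- At `η = 0` the eigenvalue term and the source `i η o` in the flux both vanish, so the equation
is exactly linear in `χ`. In particular `χ = 0` solves it for every `ε`. -/
theorem residual_zero (o : K) (ε : ℝ) (χ : W) : F.residual o 0 ε χ = F.linearization ε χ := by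
  simp [residual, linearization, lapOp, gradOp, flux, scaledEigenvalue]

/-- Lax–Milgram for the real inner product `Re ⟪·, ·⟫`. -/
theorem isInvertible_of_coercive {T : W →L[ℂ] W} {c : ℝ} (hc : 0 < c)
    (hT : ∀ v, c * ‖v‖ * ‖v‖ ≤ (⟪v, T v⟫).re) : (T.restrictScalars ℝ).IsInvertible := by
  let _ : InnerProductSpace ℝ W := InnerProductSpace.complexToReal
  let B : W →L[ℝ] W →L[ℝ] ℝ := (innerSL ℝ) ∘L (T.restrictScalars ℝ)
  have hB : IsCoercive B := ⟨c, hc, fun u => by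
    have h : B u u = (⟪T u, u⟫).re := rfl
    rw [h, ← inner_conj_symm]
    exact hT u⟩
  refine ⟨hB.continuousLinearEquivOfBilin, ?_⟩
  ext v
  refine ext_inner_right ℝ fun w => ?_
  rw [ContinuousLinearEquiv.coe_coe, hB.continuousLinearEquivOfBilin_apply]
  rfl

end Residual

end FormData
end BlochWave
end

/-! ### The analytic branch of correctors. -/

section
open scoped ContDiff
namespace BlochWave
namespace FormData

variable {d : ℕ} {W K : Type*} [NormedAddCommGroup W] [InnerProductSpace ℂ W]
    [NormedAddCommGroup K] [InnerProductSpace ℂ K] (F : FormData d W K)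

local notation "⟪" x ", " y "⟫" => inner ℂ x y

/-- Nonnegativity of the coefficients. -/
def CoefNonneg : Prop :=
  ∀ ξ : Fin d → K, 0 ≤ (∑ j, ⟪ξ j, ∑ k, F.coef j k (ξ k)⟫).re

/-- A lower bound for the Laplacian. -/
def LapBoundedBelow : Prop := ∃ c > 0, ∀ x, c * ‖x‖ ≤ ‖F.lap x‖

/-- The contribution of the corrector to the flux of the constant mode. -/
noncomputable def correctorFlux (o : K) (η : Fin d → ℝ) (χ : W) : ℂ :=
  ∑ j, ⟪(Complex.I * (η j : ℂ)) • o, F.flux o η 1 χ j⟫ -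
    ∑ j, ⟪(Complex.I * (η j : ℂ)) • o, F.flux o η 0 χ j⟫

theorem contDiff_correctorFlux (o : K) (c : ℝ) :
    ContDiff ℝ ω fun q : (Fin d → ℝ) × W => c * (F.correctorFlux o q.1 q.2).re := by
  have hN (s : ℝ) : ContDiff ℝ ω fun q : (Fin d → ℝ) × W =>
      ∑ j, ⟪(Complex.I * (q.1 j : ℂ)) • o, F.flux o q.1 s q.2 j⟫ := by
    have h1 : ContDiff ℝ ω fun q : (Fin d → ℝ) × W => ((q.1, s), q.2) := by fun_prop
    exact (F.contDiff_inner_flux o).comp h1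
  have h2 : ContDiff ℝ ω fun q : (Fin d → ℝ) × W => F.correctorFlux o q.1 q.2 :=
    (hN 1).sub (hN 0)
  have h3 : ContDiff ℝ ω fun q : (Fin d → ℝ) × W => (F.correctorFlux o q.1 q.2).re :=
    Complex.reCLM.contDiff.comp h2
  exact contDiff_const.mul h3

theorem analyticAt_correctorFlux (o : K) {h : (Fin d → ℝ) × ℝ → W} {p : (Fin d → ℝ) × ℝ}
    (hh : AnalyticAt ℝ h p) (c : ℝ) :
    AnalyticAt ℝ (fun p => c * (F.correctorFlux o p.1 (h p)).re) p := by
  have h1 : AnalyticAt ℝ (fun p : (Fin d → ℝ) × ℝ => (p.1, h p)) p := analyticAt_fst.prod hh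
  have h2 := (F.contDiff_correctorFlux o c).contDiffAt (x := (p.1, h p))
  exact AnalyticAt.fun_comp (f := fun p : (Fin d → ℝ) × ℝ => (p.1, h p)) (x := p)
    h2.analyticAt h1

theorem continuousAt_scaledEigenvalue (o : K) {h : (Fin d → ℝ) × ℝ → W} {p : (Fin d → ℝ) × ℝ}
    (hh : AnalyticAt ℝ h p) :
    ContinuousAt (fun p : (Fin d → ℝ) × ℝ => (F.scaledEigenvalue o p.1 p.2 (h p)).re) p :=
  Complex.continuous_re.continuousAt.comp (ContinuousAt.comp
    (g := fun q : ((Fin d → ℝ) × ℝ) × W => F.scaledEigenvalue o q.1.1 q.1.2 q.2)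
    (f := fun p => (p, h p)) (F.contDiff_scaledEigenvalue o).continuous.continuousAt
    (continuousAt_id.prodMk hh.continuousAt))

section Branch

variable [CompleteSpace W] [CompleteSpace K]

-- The fourth order part alone is coercive, by the lower bound on `F.lap`; the second order part is
-- nonnegative for `ε ≥ 0` and can only help. The case `ε = 0` is therefore included.
variable {F} in
theorem isInvertible_linearization (hF : F.CoefNonneg) (hlap : F.LapBoundedBelow) {ε : ℝ}
    (hε : 0 ≤ ε) : ((F.linearization ε).restrictScalars ℝ).IsInvertible := by
  obtain ⟨c, hc, hlap⟩ := hlap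
  refine isInvertible_of_coercive (c := c * c) (by positivity) fun v => ?_
  have h1 : ⟪v, F.linearization ε v⟫ = ⟪F.lap v, F.lap v⟫ +
      (ε : ℂ) * ∑ j, ⟪F.grad j v, ∑ k, F.coef j k (F.grad k v)⟫ := by
    simp [linearization, ContinuousLinearMap.adjoint_inner_right, Finset.mul_sum]
  have h2 : (⟪F.lap v, F.lap v⟫).re = ‖F.lap v‖ * ‖F.lap v‖ := by
    exact inner_self_eq_norm_mul_norm (𝕜 := ℂ) _
  rw [h1, Complex.add_re, Complex.re_ofReal_mul, h2]
  have h3 := mul_nonneg hε (hF fun j => F.grad j v)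
  have h4 := mul_self_le_mul_self (by positivity) (hlap v)
  nlinarith

/-- Near a parameter `(0, ε₀)` the corrector equation has a unique small solution, which depends
analytically on the parameters. -/
theorem exists_branch (hF : F.CoefNonneg) (hlap : F.LapBoundedBelow) (o : K) {ε₀ : ℝ}
    (hε : 0 ≤ ε₀) :
    ∃ h : (Fin d → ℝ) × ℝ → W, AnalyticAt ℝ h (0, ε₀) ∧
      (∀ᶠ p in 𝓝 ((0 : Fin d → ℝ), ε₀), F.residual o p.1 p.2 (h p) = 0) ∧
      ∀ᶠ ε in 𝓝 ε₀, h (0, ε) = 0 := by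
  set f : ((Fin d → ℝ) × ℝ) × W → W := fun p => F.residual o p.1.1 p.1.2 p.2
  set u : ((Fin d → ℝ) × ℝ) × W := ((0, ε₀), 0)
  have hf : ContDiffAt ℝ ω f u := (F.contDiff_residual o).contDiffAt
  have hfu (ε : ℝ) : f ((0, ε), 0) = 0 := by simp [f, residual_zero]
  have hinv : (fderiv ℝ f u ∘L .inr ℝ ((Fin d → ℝ) × ℝ) W).IsInvertible := by
    have h1 : HasFDerivAt f (fderiv ℝ f u) (u.1, (0 : W)) :=
      (hf.differentiableAt (by simp)).hasFDerivAt
    have h2 := h1.comp (0 : W) (hasFDerivAt_prodMk_right (𝕜 := ℝ) u.1 (0 : W))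
    -- The partial derivative in `χ` needs no computation: the restriction of `f` to the fibre over
    -- `(0, ε₀)` is already linear.
    have h3 : f ∘ (fun χ : W => (u.1, χ)) = (F.linearization ε₀).restrictScalars ℝ := by
      funext χ
      exact F.residual_zero o ε₀ χ
    rw [h3] at h2
    rw [h2.unique ((F.linearization ε₀).restrictScalars ℝ).hasFDerivAt]
    exact isInvertible_linearization hF hlap hε
  have hω : (ω : WithTop ℕ∞) ≠ 0 := by simp
  refine ⟨hf.implicitFunction hω hinv,
    (hf.contDiffAt_implicitFunction hω hinv).analyticAt, ?_, ?_⟩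
  · filter_upwards [hf.eventually_apply_implicitFunction hω hinv] with p hp
    exact hp.trans (hfu ε₀)
  -- Local uniqueness: `χ = 0` is a solution at `(0, ε)`, so the implicit function must take this
  -- value.
  · have h1 := hf.eventually_apply_eq_iff_implicitFunction hω hinv
    have h2 : Tendsto (fun ε : ℝ => (((0 : Fin d → ℝ), ε), (0 : W))) (𝓝 ε₀) (𝓝 u) :=
      Continuous.tendsto (by fun_prop) ε₀
    filter_upwards [h2.eventually h1] with ε hε
    exact hε.1 ((hfu ε).trans (hfu ε₀).symm)

end Branch

/-- `φ` is an eigenvector of the form with eigenvalue `lam`. -/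
def IsEigenvector (ρ : ℝ) (η : Fin d → ℝ) (lam : ℝ) (φ : W) : Prop :=
  φ ≠ 0 ∧ ∀ v, F.form ρ η φ v = (lam : ℂ) * ⟪F.incl v, F.incl φ⟫

theorem form_add_left (ρ : ℝ) (η : Fin d → ℝ) (u u' v : W) :
    F.form ρ η (u + u') v = F.form ρ η u v + F.form ρ η u' v := by
  simp [form, Finset.sum_add_distrib, mul_add]
  ring

theorem form_smul_left (ρ : ℝ) (η : Fin d → ℝ) (a : ℂ) (u v : W) :
    F.form ρ η (a • u) v = a * F.form ρ η u v := by
  simp [form, mul_add, Finset.mul_sum]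
  ring

theorem form_add_right (ρ : ℝ) (η : Fin d → ℝ) (u v v' : W) :
    F.form ρ η u (v + v') = F.form ρ η u v + F.form ρ η u v' := by
  simp [form, Finset.sum_add_distrib, mul_add]
  ring

theorem form_smul_right (ρ : ℝ) (η : Fin d → ℝ) (a : ℂ) (u v : W) :
    F.form ρ η u (a • v) = conj a * F.form ρ η u v := by
  simp [form, add_mul, Finset.sum_mul, mul_comm (conj a), mul_assoc]

variable {F} in
theorem IsEigenvector.smul {ρ : ℝ} {η : Fin d → ℝ} {lam : ℝ} {φ : W}
    (h : F.IsEigenvector ρ η lam φ) {a : ℂ} (ha : a ≠ 0) : F.IsEigenvector ρ η lam (a • φ) := by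
  refine ⟨smul_ne_zero ha h.1, fun v => ?_⟩
  rw [form_smul_left, h.2, map_smul, inner_smul_right]
  ring

/-- The coefficients form a symmetric matrix of operators. -/
def CoefSymm : Prop := ∀ j k x y, ⟪x, F.coef j k y⟫ = ⟪F.coef k j x, y⟫

-- Symmetry of the form makes the eigenvalue produced by the corrector real, and gives the
-- orthogonality relation behind uniqueness.
variable {F} in
theorem form_conj (hF : F.CoefSymm) (ρ : ℝ) (η : Fin d → ℝ) (u v : W) :
    conj (F.form ρ η u v) = F.form ρ η v u := by
  simp only [form, map_add, map_sum, map_mul, inner_sum, inner_conj_symm, hF _ _]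
  rw [Finset.sum_comm]
  simp

/-! ### From correctors to the lowest eigenpair. -/

section Eigen

/-- The structural properties of the operators of the Bloch problem: `e` is the constant function
and `X` the space of functions of mean value zero. -/
structure IsAdmissible (X : Submodule ℂ W) (e : W) : Prop where
  nonneg : F.CoefNonneg
  symm : F.CoefSymm
  grad_const : ∀ j, F.grad j e = 0
  lap_const : F.lap e = 0
  const_ne : e ≠ 0
  injective : Function.Injective F.incl
  inner_incl : ∀ x ∈ X, ⟪F.incl e, F.incl x⟫ = 0
  inner_grad : ∀ x ∈ X, ∀ j, ⟪F.incl e, F.grad j x⟫ = 0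
  inner_lap : ∀ x ∈ X, ⟪F.incl e, F.lap x⟫ = 0
  decomp : ∀ w, ∃ a : ℂ, ∃ x ∈ X, w = a • e + x
  lap_bounded_below : (F.restrict X).LapBoundedBelow

variable {F} {X : Submodule ℂ W} {e : W} (hF : F.IsAdmissible X e)
include hF

theorem IsAdmissible.incl_const_ne : F.incl e ≠ 0 := fun h =>
  hF.const_ne (hF.injective (h.trans (map_zero _).symm))

theorem IsAdmissible.inner_lapOp {x : W} (hx : x ∈ X) (η : Fin d → ℝ) :
    ⟪F.incl e, F.lapOp η x⟫ = 0 := by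
  simp [lapOp, hF.inner_incl x hx, hF.inner_grad x hx, hF.inner_lap x hx]

theorem IsAdmissible.lapOp_const (η : Fin d → ℝ) :
    F.lapOp η e = -(∑ j, (η j : ℂ) ^ 2) • F.incl e := by
  simp [lapOp, hF.lap_const, hF.grad_const]

theorem IsAdmissible.gradOp_const (η : Fin d → ℝ) (j : Fin d) :
    F.gradOp η j e = (Complex.I * (η j : ℂ)) • F.incl e := by
  simp [gradOp, hF.grad_const]

theorem IsAdmissible.flux_eq (η : Fin d → ℝ) (ε : ℝ) (χ : X) (j : Fin d) :
    (F.restrict X).flux (F.incl e) η ε χ j =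
      ∑ k, F.coef j k (F.gradOp η k (e + (ε : ℂ) • (χ : W))) := by
  simp [flux, hF.gradOp_const, restrict, ← gradOp_restrict]

/-- By `decomp` it suffices to test with the constant and with mean-zero functions. The first test
is the definition of `scaledEigenvalue`, the second is the vanishing of the residual. -/
theorem IsAdmissible.form_eq_of_residual [CompleteSpace X] [CompleteSpace K] {ρ : ℝ} (hρ : ρ ≠ 0)
    {η : Fin d → ℝ} {χ : X} (h : (F.restrict X).residual (F.incl e) η (ρ ^ 2)⁻¹ χ = 0) (v : W) :
    F.form ρ η (e + (((ρ ^ 2)⁻¹ : ℝ) : ℂ) • (χ : W)) v =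
      (ρ : ℂ) ^ 2 * (F.restrict X).scaledEigenvalue (F.incl e) η (ρ ^ 2)⁻¹ χ *
        ⟪F.incl v, F.incl (e + (((ρ ^ 2)⁻¹ : ℝ) : ℂ) • (χ : W))⟫ := by
  have hρ' : (ρ : ℂ) ≠ 0 := by exact_mod_cast hρ
  set ε : ℝ := (ρ ^ 2)⁻¹ with hε
  have hρε : (ρ : ℂ) ^ 2 * (ε : ℂ) = 1 := by
    rw [hε]; push_cast; field_simp
  set μ := (F.restrict X).scaledEigenvalue (F.incl e) η ε χ with hμ
  set φ := e + (ε : ℂ) • (χ : W) with hφ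
  have ho : ((‖F.incl e‖ : ℂ)) ≠ 0 := by simpa using hF.incl_const_ne
  have hlap : F.lapOp η φ = -(∑ j, (η j : ℂ) ^ 2) • F.incl e + (ε : ℂ) • F.lapOp η χ := by
    rw [hφ, map_add, map_smul, hF.lapOp_const]
  have hconst : F.form ρ η φ e = (ρ : ℂ) ^ 2 * μ * ⟪F.incl e, F.incl φ⟫ := by
    have h1 : ⟪F.incl e, F.incl φ⟫ = (‖F.incl e‖ : ℂ) ^ 2 := by
      rw [hφ, map_add, map_smul, inner_add_right, inner_smul_right, hF.inner_incl _ χ.2,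
        inner_self_eq_norm_sq_to_K]
      simp
    have h2 : ⟪F.lapOp η e, F.lapOp η φ⟫ = (∑ j, (η j : ℂ) ^ 2) ^ 2 * (‖F.incl e‖ : ℂ) ^ 2 := by
      rw [hlap, hF.lapOp_const, inner_add_right, inner_smul_left, inner_smul_right,
        inner_smul_right, inner_smul_left, hF.inner_lapOp χ.2, inner_self_eq_norm_sq_to_K]
      simp only [map_neg, map_sum, map_pow, Complex.conj_ofReal, Complex.coe_algebraMap]
      ring
    rw [form, h2, h1, hμ, scaledEigenvalue]
    simp only [← hF.flux_eq, hφ, hF.gradOp_const]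
    push_cast
    have h3 : ∀ z : ℂ, z = (ρ : ℂ) ^ 2 * ((ε : ℂ) / (‖F.incl e‖ : ℂ) ^ 2 * z) *
        (‖F.incl e‖ : ℂ) ^ 2 := fun z => by
      field_simp
      linear_combination -z * hρε
    rw [mul_add, add_mul, ← h3]
    ring
  -- Orthogonality of `F.lapOp η x` to the constant removes the `|η|²` term of `F.lapOp η φ`. The
  -- remaining factor `ε` cancels `ρ²`, both in the fourth order term and in the eigenvalue term.
  have hmean : ∀ x ∈ X, F.form ρ η φ x = (ρ : ℂ) ^ 2 * μ * ⟪F.incl x, F.incl φ⟫ := by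
    intro x hx
    have h1 := (F.restrict X).inner_residual (F.incl e) η ε χ ⟨x, hx⟩
    have hix : ⟪F.incl x, F.incl e⟫ = 0 := by
      rw [← inner_conj_symm, hF.inner_incl x hx, map_zero]
    have hil : ⟪F.lapOp η x, F.incl e⟫ = 0 := by
      rw [← inner_conj_symm, hF.inner_lapOp hx, map_zero]
    rw [h, inner_zero_right] at h1
    simp only [lapOp_restrict, gradOp_restrict, hF.flux_eq, ← hφ, ← hμ] at h1
    have h2 : ⟪F.incl x, F.incl φ⟫ = ε * ⟪F.incl x, F.incl χ⟫ := by
      rw [hφ, map_add, map_smul, inner_add_right, inner_smul_right, hix, zero_add]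
    have h3 : ⟪F.lapOp η x, F.lapOp η φ⟫ = ε * ⟪F.lapOp η x, F.lapOp η χ⟫ := by
      rw [hlap, inner_add_right, inner_smul_right, inner_smul_right, hil, mul_zero, zero_add]
    rw [form, h2, h3]
    change 0 = _ + _ - μ * ⟪F.incl x, F.incl χ⟫ at h1
    linear_combination -h1 + (⟪F.lapOp η x, F.lapOp η χ⟫ - μ * ⟪F.incl x, F.incl χ⟫) * hρε
  obtain ⟨a, x, hx, rfl⟩ := hF.decomp v
  rw [form_add_right, form_smul_right, hconst, hmean x hx, map_add F.incl (a • e), map_smul,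
    inner_add_left, inner_smul_left]
  ring

theorem IsAdmissible.const_add_ne_zero (x : X) : e + (x : W) ≠ 0 := by
  intro h
  have h1 : ⟪F.incl e, F.incl (e + (x : W))⟫ = 0 := by simp [h]
  rw [map_add, inner_add_right, hF.inner_incl _ x.2, add_zero, inner_self_eq_zero] at h1
  exact hF.incl_const_ne h1

theorem IsAdmissible.isEigenvector_of_residual [CompleteSpace X] [CompleteSpace K] {ρ : ℝ}
    (hρ : ρ ≠ 0) {η : Fin d → ℝ} {χ : X}
    (h : (F.restrict X).residual (F.incl e) η (ρ ^ 2)⁻¹ χ = 0) :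
    F.IsEigenvector ρ η
      (ρ ^ 2 * ((F.restrict X).scaledEigenvalue (F.incl e) η (ρ ^ 2)⁻¹ χ).re)
      (e + (((ρ ^ 2)⁻¹ : ℝ) : ℂ) • (χ : W)) := by
  have h1 := hF.form_eq_of_residual hρ h
  set ε : ℝ := (ρ ^ 2)⁻¹ with hε
  set φ := e + (ε : ℂ) • (χ : W) with hφ
  set μ := (F.restrict X).scaledEigenvalue (F.incl e) η ε χ with hμ
  have hφ0 : φ ≠ 0 := hF.const_add_ne_zero ((ε : ℂ) • χ)
  -- The value of the form at `(φ, φ)` is real and `⟪F.incl φ, F.incl φ⟫ ≠ 0`, so `μ` is real and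
  -- nothing is lost by taking its real part.
  have h2 : ((ρ : ℂ) ^ 2 * μ) = ((ρ ^ 2 * μ.re : ℝ) : ℂ) := by
    have h3 := form_conj hF.symm ρ η φ φ
    rw [h1 φ, map_mul, inner_conj_symm] at h3
    have h4 : ⟪F.incl φ, F.incl φ⟫ ≠ 0 := by
      rw [inner_self_ne_zero]
      exact fun h => hφ0 (hF.injective (h.trans (map_zero _).symm))
    have h5 := Complex.conj_eq_iff_re.1 (mul_right_cancel₀ h4 h3)
    rw [← h5, ← Complex.ofReal_pow, Complex.re_ofReal_mul]
  exact ⟨hφ0, fun v => by rw [h1 v, h2]⟩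

/-- Uniform coercivity of the shifted form on functions of mean value zero. -/
theorem IsAdmissible.exists_coercive [CompleteSpace X] [CompleteSpace K] :
    ∃ κ > 0, ∀ᶠ η in 𝓝 (0 : Fin d → ℝ), ∀ ρ : ℝ, 1 ≤ ρ → ∀ x ∈ X, x ≠ 0 → ∀ lam < κ,
      lam * ‖F.incl x‖ ^ 2 < (F.form ρ η x x).re := by
  obtain ⟨c, hc, hlap⟩ := hF.lap_bounded_below
  -- For small `η` the shifted Laplacian keeps half of the lower bound `c`. Neither this
  -- neighbourhood nor `κ` depends on `ρ`, because `ρ ≥ 1` only increases the form; the summand `1`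
  -- keeps the denominator positive.
  refine ⟨(c / 2) ^ 2 / (‖F.incl‖ ^ 2 + 1), by positivity, ?_⟩
  have h1 : Tendsto (fun η => ‖(F.restrict X).lapOp η - (F.restrict X).lapOp 0‖)
      (𝓝 (0 : Fin d → ℝ)) (𝓝 0) := by
    have := (((F.restrict X).contDiff_lapOp.continuous).sub
      (continuous_const (y := (F.restrict X).lapOp 0))).norm.tendsto (0 : Fin d → ℝ)
    simpa using this
  filter_upwards [h1.eventually (gt_mem_nhds (half_pos hc))] with η hη ρ hρ x hx hx0 lam hlam
  have hxpos : 0 < ‖x‖ := norm_pos_iff.2 hx0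
  have h2 : c / 2 * ‖x‖ ≤ ‖F.lapOp η x‖ := by
    have h3 := hlap ⟨x, hx⟩
    have h4 : (F.restrict X).lapOp 0 = (F.restrict X).lap := by simp [lapOp]
    have h5 := ((F.restrict X).lapOp η - (F.restrict X).lapOp 0).le_opNorm ⟨x, hx⟩
    rw [h4] at h5 hη
    rw [sub_apply, lapOp_restrict] at h5
    change c * ‖x‖ ≤ _ at h3
    change _ ≤ _ * ‖x‖ at h5
    have h6 := norm_sub_norm_le ((F.restrict X).lap ⟨x, hx⟩) (F.lapOp η x)
    rw [norm_sub_rev] at h6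
    nlinarith
  have h3 : (F.form ρ η x x).re = (∑ j, ⟪F.gradOp η j x, ∑ k, F.coef j k (F.gradOp η k x)⟫).re +
      ρ ^ 2 * ‖F.lapOp η x‖ ^ 2 := by
    rw [form, inner_self_eq_norm_sq_to_K, Complex.add_re]
    change _ + ((ρ : ℂ) ^ 2 * (‖F.lapOp η x‖ : ℂ) ^ 2).re = _
    rw [← Complex.ofReal_pow, Complex.re_ofReal_mul, ← Complex.ofReal_pow, Complex.ofReal_re]
  have h4 := hF.nonneg fun j => F.gradOp η j x
  have h5 : (c / 2 * ‖x‖) ^ 2 ≤ ‖F.lapOp η x‖ ^ 2 := by gcongr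
  have h6 : ‖F.lapOp η x‖ ^ 2 ≤ ρ ^ 2 * ‖F.lapOp η x‖ ^ 2 :=
    le_mul_of_one_le_left (by positivity) (by nlinarith)
  have h7 : ‖F.incl x‖ ^ 2 ≤ ‖F.incl‖ ^ 2 * ‖x‖ ^ 2 := by
    rw [← mul_pow]; gcongr; exact F.incl.le_opNorm x
  rw [lt_div_iff₀ (by positivity)] at hlam
  rcases le_or_gt lam 0 with hl | hl
  · have : 0 < (c / 2 * ‖x‖) ^ 2 := by positivity
    have : lam * ‖F.incl x‖ ^ 2 ≤ 0 := mul_nonpos_of_nonpos_of_nonneg hl (by positivity)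
    linarith
  · have h8 : lam * ‖F.incl x‖ ^ 2 ≤ lam * (‖F.incl‖ ^ 2 * ‖x‖ ^ 2) := by gcongr
    have h9 : lam * (‖F.incl‖ ^ 2 + 1) * ‖x‖ ^ 2 < (c / 2) ^ 2 * ‖x‖ ^ 2 := by gcongr
    have h10 : 0 < lam * ‖x‖ ^ 2 := by positivity
    nlinarith

omit hF in
theorem IsEigenvector.re_form_self {ρ : ℝ} {η : Fin d → ℝ} {lam : ℝ} {φ : W}
    (h : F.IsEigenvector ρ η lam φ) : (F.form ρ η φ φ).re = lam * ‖F.incl φ‖ ^ 2 := by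
  rw [h.2, inner_self_eq_norm_sq_to_K, Complex.re_ofReal_mul]
  norm_cast

/-- Two eigenvectors with small eigenvalues and the same mean value coincide. -/
theorem IsAdmissible.eigenvector_unique {ρ κ : ℝ} {η : Fin d → ℝ}
    (hco : ∀ x ∈ X, x ≠ 0 → ∀ lam < κ, lam * ‖F.incl x‖ ^ 2 < (F.form ρ η x x).re)
    {φ φ' : W} {lam lam' : ℝ} (hl : lam < κ) (hl' : lam' < κ)
    (h : F.IsEigenvector ρ η lam φ) (h' : F.IsEigenvector ρ η lam' φ') (hX : φ - φ' ∈ X) :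
    φ = φ' ∧ lam = lam' := by
  have key : φ = φ' := by
    by_contra hne
    have hco := hco _ hX (sub_ne_zero.2 hne)
    have h1 : F.form ρ η (φ - φ') (φ - φ') = F.form ρ η φ φ + F.form ρ η φ' φ' -
        (F.form ρ η φ φ' + F.form ρ η φ' φ) := by
      have : φ - φ' = φ + (-1 : ℂ) • φ' := by simp [sub_eq_add_neg]
      rw [this]
      simp only [form_add_left, form_add_right, form_smul_left, form_smul_right]
      simp
      ring
    have h2 := form_conj hF.symm ρ η φ φ'
    rw [h.2, h'.2, map_mul, inner_conj_symm, Complex.conj_ofReal] at h2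
    have h3 : ‖F.incl (φ - φ')‖ ^ 2 = ‖F.incl φ‖ ^ 2 + ‖F.incl φ'‖ ^ 2 -
        2 * (⟪F.incl φ, F.incl φ'⟫).re := by
      rw [map_sub, @norm_sub_sq ℂ]
      change _ - 2 * (⟪F.incl φ, F.incl φ'⟫).re + _ = _
      ring
    have hsymm : (⟪F.incl φ', F.incl φ⟫).re = (⟪F.incl φ, F.incl φ'⟫).re := by
      rw [← inner_conj_symm, Complex.conj_re]
    have h4 : (F.form ρ η (φ - φ') (φ - φ')).re = lam * ‖F.incl φ‖ ^ 2 + lam' * ‖F.incl φ'‖ ^ 2 -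
        (lam + lam') * (⟪F.incl φ, F.incl φ'⟫).re := by
      rw [h1, Complex.sub_re, Complex.add_re, Complex.add_re, h.re_form_self, h'.re_form_self,
        h.2, h'.2, Complex.re_ofReal_mul, Complex.re_ofReal_mul, hsymm]
      ring
    have h5 : (lam - lam') * (⟪F.incl φ, F.incl φ'⟫).re = 0 := by
      have := congrArg Complex.re h2
      rw [Complex.re_ofReal_mul, Complex.re_ofReal_mul] at this
      linarith
    -- By symmetry either the eigenvalues agree or the real part of the inner product vanishes. In
    -- both cases the form at `φ - φ'` is at most `max lam lam' * ‖F.incl (φ - φ')‖ ^ 2`, against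
    -- the strict lower bound on `X`.
    have hm := hco (max lam lam') (max_lt hl hl')
    rw [h4, h3] at hm
    rcases mul_eq_zero.1 h5 with h6 | h6
    · obtain rfl : lam = lam' := sub_eq_zero.1 h6
      rw [max_self] at hm
      linarith
    · rw [h6] at hm
      have h7 := mul_le_mul_of_nonneg_right (le_max_left lam lam') (sq_nonneg ‖F.incl φ‖)
      have h8 := mul_le_mul_of_nonneg_right (le_max_right lam lam') (sq_nonneg ‖F.incl φ'‖)
      linarith
  refine ⟨key, ?_⟩
  subst key
  have h1 := h.re_form_self.symm.trans h'.re_form_self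
  have h2 : F.incl φ ≠ 0 := fun h0 => h.1 (hF.injective (h0.trans (map_zero _).symm))
  exact mul_right_cancel₀ (by positivity) h1

/-- An eigenvector with a small eigenvalue is a multiple of any given eigenvector of mean value
one with a small eigenvalue. -/
theorem IsAdmissible.exists_smul_of_isEigenvector {ρ κ : ℝ} {η : Fin d → ℝ}
    (hco : ∀ x ∈ X, x ≠ 0 → ∀ lam < κ, lam * ‖F.incl x‖ ^ 2 < (F.form ρ η x x).re)
    {x : X} {φ : W} {lam₀ lam : ℝ} (hl₀ : lam₀ < κ) (hl : lam < κ)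
    (h₀ : F.IsEigenvector ρ η lam₀ (e + (x : W))) (h : F.IsEigenvector ρ η lam φ) :
    lam = lam₀ ∧ ∃ a : ℂ, φ = a • (e + (x : W)) := by
  obtain ⟨a, y, hy, rfl⟩ := hF.decomp φ
  -- With `a = 0` the eigenvector would lie in `X`, where coercivity excludes eigenvalues below `κ`.
  have ha : a ≠ 0 := by
    rintro rfl
    rw [zero_smul, zero_add] at h
    have := hco y hy h.1 lam hl
    rw [h.re_form_self] at this
    exact lt_irrefl _ this
  have h1 := h.smul (inv_ne_zero ha)
  rw [smul_add, inv_smul_smul₀ ha] at h1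
  obtain ⟨h2, h3⟩ := hF.eigenvector_unique hco hl hl₀ h1 h₀ (by
    rw [add_sub_add_left_eq_sub]
    exact X.sub_mem (X.smul_mem _ hy) x.2)
  refine ⟨h3, a, ?_⟩
  rw [← h2, smul_add, smul_inv_smul₀ ha]

/-- A small eigenvalue with an eigenvector of mean value one is the smallest eigenvalue. -/
theorem IsAdmissible.isLeast {ρ κ : ℝ} {η : Fin d → ℝ}
    (hco : ∀ x ∈ X, x ≠ 0 → ∀ lam < κ, lam * ‖F.incl x‖ ^ 2 < (F.form ρ η x x).re)
    {x : X} {lam₀ : ℝ} (hl₀ : lam₀ < κ) (h₀ : F.IsEigenvector ρ η lam₀ (e + (x : W))) :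
    IsLeast {lam | ∃ φ, F.IsEigenvector ρ η lam φ} lam₀ := by
  refine ⟨⟨_, h₀⟩, fun lam ⟨φ, hφ⟩ => ?_⟩
  -- A smaller eigenvalue would again be below `κ`, hence equal to `lam₀`.
  by_contra! hlt
  exact hlt.ne (hF.exists_smul_of_isEigenvector hco hl₀ (hlt.trans hl₀) h₀ hφ).1

end Eigen

end FormData
end BlochWave
end

/-! ### Iterated partial derivatives, homogeneity and uniform bounds. -/

section
namespace BlochWave

variable {d : ℕ} {E E' : Type*} [NormedAddCommGroup E] [NormedSpace ℝ E]
  [NormedAddCommGroup E'] [NormedSpace ℝ E']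

/-- Iterated partial derivatives along a list of coordinates. -/
noncomputable def iterPartial (l : List (Fin d)) (f : (Fin d → ℝ) → E) : (Fin d → ℝ) → E :=
  l.foldr partialEta f

@[simp] theorem iterPartial_nil (f : (Fin d → ℝ) → E) : iterPartial [] f = f := rfl

@[simp] theorem iterPartial_cons (j : Fin d) (l : List (Fin d)) (f : (Fin d → ℝ) → E) :
    iterPartial (j :: l) f = partialEta j (iterPartial l f) := rfl

/-- The list of coordinates described by a multi-index. -/
def indexList (β : Fin d → ℕ) : List (Fin d) :=
  (List.finRange d).flatMap fun j => List.replicate (β j) j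

theorem multiPartial_eq_iterPartial (β : Fin d → ℕ) (f : (Fin d → ℝ) → E) :
    multiPartial β f = iterPartial (indexList β) f := by
  unfold multiPartial iterPartial indexList
  generalize List.finRange d = L
  induction L with
  | nil => rfl
  | cons j L ih =>
    simp only [List.foldr_cons, List.flatMap_cons, List.foldr_append, ih]
    generalize List.foldr partialEta f (List.flatMap (fun j => List.replicate (β j) j) L) = g
    induction β j with
    | zero => rfl
    | succ n ihn => rw [Function.iterate_succ_apply', ihn, List.replicate_succ, List.foldr_cons]

theorem length_indexList (β : Fin d → ℕ) : (indexList β).length = ∑ j, β j := by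
  simp [indexList, List.length_flatMap, List.sum_ofFn, ← List.ofFn_eq_map]

theorem count_indexList (β : Fin d → ℕ) (a : Fin d) : (indexList β).count a = β a := by
  rw [indexList, List.count_flatMap]
  have : (List.count a ∘ fun j => List.replicate (β j) j) = fun j => if j = a then β j else 0 := by
    funext j
    simp [List.count_replicate]
  rw [this, ← List.ofFn_eq_map, List.sum_ofFn]
  simp

theorem count_single (a j : Fin d) : unitIndex j a = List.count a [j] := by
  by_cases h : a = j
  · subst h; simp [unitIndex]
  · simp [unitIndex, h, Ne.symm h]

/-- The count of each entry fixes the list only up to order. Keeping both orders avoids an appeal to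
the symmetry of second derivatives. -/
theorem indexList_unitIndex_add (j k : Fin d) :
    indexList (unitIndex j + unitIndex k) = [j, k] ∨
      indexList (unitIndex j + unitIndex k) = [k, j] := by
  have h : (indexList (unitIndex j + unitIndex k)).Perm [j, k] := by
    rw [List.perm_iff_count]
    intro a
    rw [count_indexList, ← List.singleton_append, List.count_append, Pi.add_apply, count_single,
      count_single]
  generalize indexList (unitIndex j + unitIndex k) = L at h
  have hl := h.length_eq
  match L, hl with
  | [x, y], _ =>
    have hx : x ∈ [j, k] := h.subset (by simp)
    simp only [List.mem_cons, List.not_mem_nil, or_false] at hx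
    rcases hx with rfl | rfl
    · left
      rw [List.perm_cons, List.perm_singleton] at h
      rw [h]
    · right
      have h' := h.trans (List.Perm.swap _ _ _)
      rw [List.perm_cons, List.perm_singleton] at h'
      rw [h']

theorem partialEta_congr {f g : (Fin d → ℝ) → E} {x : Fin d → ℝ} (h : f =ᶠ[𝓝 x] g) (j : Fin d) :
    partialEta j f =ᶠ[𝓝 x] partialEta j g := by
  filter_upwards [h.fderiv (𝕜 := ℝ)] with y hy
  rw [partialEta, partialEta, hy]

theorem iterPartial_congr {f g : (Fin d → ℝ) → E} {x : Fin d → ℝ} (h : f =ᶠ[𝓝 x] g)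
    (l : List (Fin d)) : iterPartial l f =ᶠ[𝓝 x] iterPartial l g := by
  induction l with
  | nil => exact h
  | cons j l ih => exact partialEta_congr ih j

theorem _root_.AnalyticAt.partialEta [CompleteSpace E] {f : (Fin d → ℝ) → E} {x : Fin d → ℝ}
    (hf : AnalyticAt ℝ f x) (j : Fin d) : AnalyticAt ℝ (BlochWave.partialEta j f) x :=
  ((ContinuousLinearMap.apply ℝ E (Pi.single j 1 : Fin d → ℝ)).analyticAt _).comp hf.fderiv

theorem _root_.AnalyticAt.iterPartial [CompleteSpace E] {f : (Fin d → ℝ) → E} {x : Fin d → ℝ}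
    (hf : AnalyticAt ℝ f x) (l : List (Fin d)) : AnalyticAt ℝ (BlochWave.iterPartial l f) x := by
  induction l with
  | nil => exact hf
  | cons j l ih => exact ih.partialEta j

theorem iterPartial_add [CompleteSpace E] {f g : (Fin d → ℝ) → E} {x : Fin d → ℝ}
    (hf : AnalyticAt ℝ f x) (hg : AnalyticAt ℝ g x) (l : List (Fin d)) :
    iterPartial l (f + g) =ᶠ[𝓝 x] iterPartial l f + iterPartial l g := by
  induction l with
  | nil => rfl
  | cons j l ih =>
    refine (partialEta_congr ih j).trans ?_
    filter_upwards [(hf.iterPartial l).eventually_analyticAt,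
      (hg.iterPartial l).eventually_analyticAt] with y h1 h2
    simp [partialEta, fderiv_add h1.differentiableAt h2.differentiableAt]

theorem iterPartial_clm_comp [CompleteSpace E] (L : E →L[ℝ] E') {f : (Fin d → ℝ) → E}
    {x : Fin d → ℝ} (hf : AnalyticAt ℝ f x) (l : List (Fin d)) :
    iterPartial l (fun η => L (f η)) =ᶠ[𝓝 x] fun η => L (iterPartial l f η) := by
  induction l with
  | nil => rfl
  | cons j l ih =>
    refine (partialEta_congr ih j).trans ?_
    filter_upwards [(hf.iterPartial l).eventually_analyticAt] with y hy
    have := (L.hasFDerivAt.comp y hy.differentiableAt.hasFDerivAt).fderiv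
    rw [partialEta, iterPartial_cons, partialEta]
    exact congrArg (fun T => T (Pi.single j 1)) this

theorem iterPartial_const_add (a : E) (f : (Fin d → ℝ) → E) {l : List (Fin d)} (hl : l ≠ []) :
    iterPartial l (fun η => a + f η) = iterPartial l f := by
  induction l with
  | nil => exact absurd rfl hl
  | cons j l ih =>
    rcases eq_or_ne l [] with rfl | h
    · funext η
      simp [partialEta]
    · rw [iterPartial_cons, ih h, iterPartial_cons]

/-- Partial derivatives of a function that is homogeneous for a fixed dilation. -/
theorem iterPartial_dilation {f : (Fin d → ℝ) → E} {t s : ℝ}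
    (h : ∀ᶠ η in 𝓝 (0 : Fin d → ℝ), f (t • η) = s • f η) (l : List (Fin d)) :
    ∀ᶠ η in 𝓝 (0 : Fin d → ℝ), t ^ l.length • iterPartial l f (t • η) = s • iterPartial l f η := by
  induction l with
  | nil => simpa using h
  | cons j l ih =>
    have h1 : (fun η => t ^ l.length • iterPartial l f (t • η)) =ᶠ[𝓝 0]
      (fun η => s • iterPartial l f η) := ih
    filter_upwards [h1.fderiv (𝕜 := ℝ)] with η hη
    have h2 := congrArg (fun T => T (Pi.single j 1)) hη
    beta_reduce at h2
    rw [show (fun η => t ^ l.length • iterPartial l f (t • η)) =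
      t ^ l.length • fun η => iterPartial l f (t • η) from rfl,
      show (fun η => s • iterPartial l f η) = s • iterPartial l f from rfl,
      fderiv_const_smul_field, fderiv_const_smul_field, Pi.smul_apply, Pi.smul_apply,
      fderiv_comp_smul] at h2
    simpa [partialEta, pow_succ, mul_smul] using h2

/-- At the fixed point `η = 0` of the dilation the derivative `D` satisfies `t ^ l.length • D = s •
D`. This serves both for parity (`t = -1`) and for counting degrees (`t = 2`). -/
theorem iterPartial_eq_zero_of_dilation {f : (Fin d → ℝ) → E} {t s : ℝ}
    (h : ∀ᶠ η in 𝓝 (0 : Fin d → ℝ), f (t • η) = s • f η) {l : List (Fin d)}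
    (hl : t ^ l.length ≠ s) : iterPartial l f 0 = 0 := by
  have h1 := (iterPartial_dilation h l).self_of_nhds
  rw [smul_zero, ← sub_eq_zero, ← sub_smul] at h1
  exact (smul_eq_zero.1 h1).resolve_left (sub_ne_zero.2 hl)

/-- Iterated partial derivatives in the first variable of a function of two variables. -/
noncomputable def jointPartial (l : List (Fin d)) (f : (Fin d → ℝ) × ℝ → E) :
    (Fin d → ℝ) × ℝ → E :=
  l.foldr (fun j g p => fderiv ℝ g p (Pi.single j 1, 0)) f

theorem _root_.AnalyticAt.jointPartial [CompleteSpace E] {f : (Fin d → ℝ) × ℝ → E}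
    {p : (Fin d → ℝ) × ℝ} (hf : AnalyticAt ℝ f p) (l : List (Fin d)) :
    AnalyticAt ℝ (BlochWave.jointPartial l f) p := by
  induction l with
  | nil => exact hf
  | cons j l ih =>
    exact ((ContinuousLinearMap.apply ℝ E ((Pi.single j 1 : Fin d → ℝ), (0 : ℝ))).analyticAt _).comp
      ih.fderiv

/-- Differentiating each slice separately says nothing about dependence on the second variable.
Reading the same derivative as one of the joint function in the direction `(eⱼ, 0)` shows that it is
analytic, hence continuous, in both variables. The identity is claimed on a neighbourhood so that it
can be differentiated again. -/
theorem iterPartial_eq_jointPartial [CompleteSpace E] {f : (Fin d → ℝ) × ℝ → E}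
    {p₀ : (Fin d → ℝ) × ℝ} (hf : AnalyticAt ℝ f p₀) (l : List (Fin d)) :
    ∀ᶠ p in 𝓝 p₀, iterPartial l (fun η => f (η, p.2)) p.1 = jointPartial l f p := by
  induction l with
  | nil => exact Eventually.of_forall fun _ => rfl
  | cons j l ih =>
    filter_upwards [ih.eventually_nhds, (hf.jointPartial l).eventually_analyticAt] with p h1 h2
    have h3 : Tendsto (fun η : Fin d → ℝ => (η, p.2)) (𝓝 p.1) (𝓝 p) :=
      Continuous.tendsto' (by fun_prop) _ _ rfl
    have h4 : iterPartial l (fun η => f (η, p.2)) =ᶠ[𝓝 p.1]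
        fun η => jointPartial l f (η, p.2) := h3.eventually h1
    rw [iterPartial_cons, partialEta, h4.fderiv_eq]
    have h5 := (h2.differentiableAt.hasFDerivAt (x := (p.1, p.2))).comp p.1
      (hasFDerivAt_prodMk_left (𝕜 := ℝ) p.1 p.2)
    exact congrArg (fun T => T (Pi.single j 1)) h5.fderiv

theorem exists_bound_iterPartial [CompleteSpace E] {f : (Fin d → ℝ) × ℝ → E} {ε₀ : ℝ}
    (hf : AnalyticAt ℝ f (0, ε₀)) (l : List (Fin d)) :
    ∃ C, ∀ᶠ ε in 𝓝 ε₀, ‖iterPartial l (fun η => f (η, ε)) 0‖ ≤ C := by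
  refine ⟨‖jointPartial l f (0, ε₀)‖ + 1, ?_⟩
  have h1 := (hf.jointPartial l).continuousAt.norm.eventually
    (ge_mem_nhds (lt_add_one ‖jointPartial l f (0, ε₀)‖))
  have h2 : Tendsto (fun ε : ℝ => ((0 : Fin d → ℝ), ε)) (𝓝 ε₀) (𝓝 (0, ε₀)) :=
    Continuous.tendsto (by fun_prop) _
  filter_upwards [h2.eventually h1, h2.eventually (iterPartial_eq_jointPartial hf l)] with ε h3 h4
  rwa [← h4] at h3

/-- A locally uniform bound on `[0, 1]` is uniform. -/
theorem exists_uniform_bound {P : ℝ → ℝ → Prop} (hP : ∀ ε a b, a ≤ b → P ε a → P ε b)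
    (h : ∀ ε₀ ∈ Set.Icc (0 : ℝ) 1, ∃ C, ∀ᶠ ε in 𝓝 ε₀, P ε C) :
    ∃ C, ∀ ε ∈ Set.Icc (0 : ℝ) 1, P ε C := by
  refine isCompact_Icc.induction_on (p := fun s => ∃ C, ∀ ε ∈ s, P ε C) ⟨0, by simp⟩ ?_ ?_ ?_
  · rintro s t hst ⟨C, hC⟩
    exact ⟨C, fun ε hε => hC ε (hst hε)⟩
  · rintro s t ⟨C, hC⟩ ⟨C', hC'⟩
    refine ⟨max C C', fun ε hε => ?_⟩
    rcases hε with hε | hε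
    · exact hP _ _ _ (le_max_left _ _) (hC ε hε)
    · exact hP _ _ _ (le_max_right _ _) (hC' ε hε)
  · intro ε₀ hε₀
    obtain ⟨C, hC⟩ := h ε₀ hε₀
    exact ⟨_, mem_nhdsWithin_of_mem_nhds hC, C, fun ε hε => hε⟩

theorem iterPartial_pair_quadratic (m : Fin d → Fin d → ℝ) (j k : Fin d) :
    iterPartial [j, k] (fun η : Fin d → ℝ => ∑ a, ∑ b, m a b * (η a * η b)) 0 = m j k + m k j := by
  have h1 (η : Fin d → ℝ) : HasFDerivAt (fun η : Fin d → ℝ => ∑ a, ∑ b, m a b * (η a * η b))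
      (∑ a, ∑ b, m a b • (η a • ContinuousLinearMap.proj (R := ℝ) (φ := fun _ : Fin d => ℝ) b +
        η b • ContinuousLinearMap.proj a)) η := by
    refine HasFDerivAt.fun_sum fun a _ => HasFDerivAt.fun_sum fun b _ => ?_
    exact ((hasFDerivAt_apply a η).mul (hasFDerivAt_apply b η)).const_mul _
  have h2 : partialEta k (fun η : Fin d → ℝ => ∑ a, ∑ b, m a b * (η a * η b)) =
      fun η => ∑ a, (m a k + m k a) * η a := by
    funext η
    rw [partialEta, (h1 η).fderiv]
    simp [Pi.single_apply, Finset.sum_add_distrib, add_mul]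
  have h3 : HasFDerivAt (fun η : Fin d → ℝ => ∑ a, (m a k + m k a) * η a)
      (∑ a, (m a k + m k a) • ContinuousLinearMap.proj (R := ℝ) (φ := fun _ : Fin d => ℝ) a) 0 :=
    HasFDerivAt.fun_sum fun a _ => (hasFDerivAt_apply a _).const_mul _
  rw [iterPartial_cons, iterPartial_cons, iterPartial_nil, h2, partialEta, h3.fderiv]
  simp [Pi.single_apply]

end BlochWave
end

/-! ### Fourier analysis on the cell: Riesz–Fischer, Sobolev spaces as Hilbert spaces, multipliers.
-/

section
namespace BlochWave

variable {d : ℕ}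

local notation "⟪" x ", " y "⟫" => inner ℂ x y

instance (d : ℕ) : IsFiniteMeasure (muY d) := by
  refine ⟨?_⟩
  rw [Measure.restrict_apply_univ, cellY, volume_pi_pi]
  exact ENNReal.prod_lt_top fun j _ => by
    rw [Real.volume_Ico]
    exact ENNReal.ofReal_lt_top

theorem norm_expY (n : Fin d → ℤ) (y : Fin d → ℝ) : ‖expY n y‖ = 1 := by
  simp [expY, Complex.norm_exp]

theorem continuous_expY (n : Fin d → ℤ) : Continuous (expY n) := by unfold expY; fun_prop

theorem expY_zero (y : Fin d → ℝ) : expY 0 y = 1 := by simp [expY]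

theorem expY_mul_conj (n m : Fin d → ℤ) (y : Fin d → ℝ) :
    expY m y * conj (expY n y) = expY (m - n) y := by
  simp only [expY, ← Complex.exp_conj, ← Complex.exp_add]
  congr 1
  simp only [map_mul, Complex.conj_I, map_sum, Complex.conj_ofReal, Pi.sub_apply, Int.cast_sub,
    sub_mul, Finset.sum_sub_distrib, map_intCast]
  ring

theorem conj_expY (n : Fin d → ℤ) (y : Fin d → ℝ) : conj (expY n y) = expY (-n) y := by
  have := expY_mul_conj n 0 y
  rwa [expY_zero, one_mul, zero_sub] at this

theorem integral_expY_of_ne {n : Fin d → ℤ} (hn : n ≠ 0) : ∫ y in cellY d, expY n y = 0 := by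
  obtain ⟨j, hj⟩ := Function.ne_iff.1 hn
  have hj' : (n j : ℂ) ≠ 0 := by exact_mod_cast hj
  have h1 : muY d = Measure.pi fun _ : Fin d => (volume : Measure ℝ).restrict
      (Set.Ico 0 (2 * Real.pi)) := Measure.restrict_pi_pi _ _
  have h2 : expY n = fun y : Fin d → ℝ => ∏ j, Complex.exp (Complex.I * n j * y j) := by
    funext y
    simp [expY, Finset.mul_sum, Complex.exp_sum, mul_assoc]
  change ∫ y, expY n y ∂(muY d) = 0
  rw [h1, h2, integral_fintype_prod_eq_prod (f := fun j (t : ℝ) => Complex.exp (Complex.I * n j * t))]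
  refine Finset.prod_eq_zero (Finset.mem_univ j) ?_
  rw [integral_Ico_eq_integral_Ioc, ← intervalIntegral.integral_of_le (by positivity),
    integral_exp_mul_complex (by simp [hj'])]
  have h3 : Complex.exp (Complex.I * n j * ((2 * Real.pi : ℝ) : ℂ)) = 1 := by
    rw [Complex.exp_eq_one_iff]
    exact ⟨n j, by push_cast; ring⟩
  rw [h3]
  simp

/-- The volume `(2π)^d` of the cell. -/
noncomputable def volY (d : ℕ) : ℝ := (2 * Real.pi) ^ d

theorem volY_pos (d : ℕ) : 0 < volY d := by unfold volY; positivity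

theorem volume_real_cellY : (volume : Measure (Fin d → ℝ)).real (cellY d) = volY d := by
  rw [Measure.real, cellY, volume_pi_pi]
  simp [volY, Real.pi_pos.le]

/-- The character `e^{i n·y}` as an element of `L²_♯(Y)`. -/
noncomputable def expL2 (n : Fin d → ℤ) : L2Y d :=
  (MemLp.of_bound (continuous_expY n).aestronglyMeasurable 1
    (Eventually.of_forall fun y => (norm_expY n y).le) : MemLp (expY n) 2 (muY d)).toLp _

theorem coeFn_expL2 (n : Fin d → ℤ) : expL2 n =ᵐ[muY d] expY n := MemLp.coeFn_toLp _

theorem inner_expL2 (n : Fin d → ℤ) (u : L2Y d) : ⟪expL2 n, u⟫ = volY d * fourierY u n := by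
  rw [L2.inner_def, fourierY, meanY, Complex.real_smul]
  have h : ∫ y, ⟪expL2 n y, u y⟫ ∂(muY d) = ∫ y in cellY d, u y * conj (expY n y) := by
    refine integral_congr_ae ?_
    filter_upwards [coeFn_expL2 n] with y hy
    rw [hy, RCLike.inner_apply]
  rw [h, ← mul_assoc, ← Complex.ofReal_mul, volY, mul_inv_cancel₀ (by positivity),
    Complex.ofReal_one, one_mul]

theorem fourierY_expL2 (n m : Fin d → ℤ) : fourierY (expL2 m) n = if n = m then 1 else 0 := by
  have h : fourierY (expL2 m) n = meanY fun y => expY (m - n) y := by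
    unfold fourierY meanY
    congr 1
    refine integral_congr_ae ?_
    filter_upwards [coeFn_expL2 m] with y hy
    rw [hy, expY_mul_conj]
  rw [h, meanY]
  split_ifs with hnm
  · subst hnm
    simp only [sub_self, expY_zero]
    rw [setIntegral_const, volume_real_cellY, smul_smul, ← volY,
      inv_mul_cancel₀ (volY_pos d).ne', one_smul]
  · rw [integral_expY_of_ne (sub_ne_zero.2 (Ne.symm hnm)), smul_zero]

theorem fourierY_ext {u v : L2Y d} (h : ∀ n, fourierY u n = fourierY v n) : u = v := by
  rw [← sub_eq_zero]
  refine eq_zero_of_fourierY _ fun n => ?_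
  have : u - v = u + (-1 : ℂ) • v := by simp [sub_eq_add_neg]
  rw [this, fourierY_add, fourierY_smul, h]
  ring

theorem fourierY_sum {ι : Type*} (s : Finset ι) (u : ι → L2Y d) (n : Fin d → ℤ) :
    fourierY (∑ i ∈ s, u i) n = ∑ i ∈ s, fourierY (u i) n := by
  have h : ∀ v : L2Y d, fourierY v n = (volY d : ℂ)⁻¹ * ⟪expL2 n, v⟫ := fun v => by
    rw [inner_expL2, inv_mul_cancel_left₀]
    exact_mod_cast (volY_pos d).ne'
  simp only [h, inner_sum, Finset.mul_sum]

theorem hasSum_norm_sq (u : L2Y d) :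
    HasSum (fun n => volY d * ‖fourierY u n‖ ^ 2) (‖u‖ ^ 2) := by
  have h := (hasSum_sq_fourierY u).mul_left (volY d)
  convert! h using 1
  rw [meanY, smul_eq_mul, ← volY, mul_inv_cancel_left₀ (volY_pos d).ne']
  rw [← @inner_self_eq_norm_sq ℂ, L2.inner_def]
  change Complex.re (∫ a, ⟪u a, u a⟫ ∂(muY d)) = _
  have : ∀ a, ⟪u a, u a⟫ = ((‖u a‖ ^ 2 : ℝ) : ℂ) := fun a => by
    rw [inner_self_eq_norm_sq_to_K]; simp
  simp only [this]
  rw [integral_complex_ofReal, Complex.ofReal_re]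

/-- The Riesz–Fischer theorem on the cell. -/
theorem exists_fourierY_eq {a : (Fin d → ℤ) → ℂ} (ha : Summable fun n => ‖a n‖ ^ 2) :
    ∃ u : L2Y d, ∀ n, fourierY u n = a n := by
  have hv := volY_pos d
  -- The factor `|Y|^{-1/2}` turns the characters into an orthonormal family for the unnormalized
  -- Lebesgue measure.
  set s : ℝ := (√(volY d))⁻¹ with hs
  have hs2 : s * s * volY d = 1 := by
    rw [hs, ← mul_inv, Real.mul_self_sqrt hv.le, inv_mul_cancel₀ hv.ne']
  have hs0 : (s : ℂ) ≠ 0 := by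
    intro h
    rw [Complex.ofReal_eq_zero.1 h] at hs2
    simp at hs2
  have hort : Orthonormal ℂ fun n : Fin d → ℤ => (s : ℂ) • (expL2 n : L2Y d) := by
    rw [orthonormal_iff_ite]
    intro n m
    rw [inner_smul_left, inner_smul_right, inner_expL2, fourierY_expL2]
    split_ifs
    · rw [Complex.conj_ofReal]
      norm_cast
      linarith
    · simp
  have hbot : (Submodule.span ℂ (Set.range fun n : Fin d → ℤ => (s : ℂ) • (expL2 n : L2Y d)))ᗮ =
      ⊥ := by
    rw [Submodule.eq_bot_iff]
    intro u hu
    refine eq_zero_of_fourierY u fun n => ?_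
    have := (Submodule.mem_orthogonal _ _).1 hu _ (Submodule.subset_span ⟨n, rfl⟩)
    rw [inner_smul_left, inner_expL2, Complex.conj_ofReal] at this
    have hv' : (volY d : ℂ) ≠ 0 := by exact_mod_cast hv.ne'
    simpa [hs0, hv'] using this
  let b := HilbertBasis.mkOfOrthogonalEqBot hort hbot
  have hmem : Memℓp (fun n => (s : ℂ)⁻¹ * a n) 2 := by
    refine memℓp_gen ?_
    simp only [ENNReal.toReal_ofNat, Real.rpow_ofNat, norm_mul, mul_pow]
    exact ha.mul_left _
  refine ⟨b.repr.symm ⟨_, hmem⟩, fun n => ?_⟩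
  have h1 := b.repr_apply_apply (b.repr.symm ⟨_, hmem⟩) n
  rw [LinearIsometryEquiv.apply_symm_apply, HilbertBasis.coe_mkOfOrthogonalEqBot, inner_smul_left,
    inner_expL2, Complex.conj_ofReal] at h1
  change (s : ℂ)⁻¹ * a n = _ at h1
  have hs2' : (s : ℂ) * s * volY d = 1 := by exact_mod_cast hs2
  rw [inv_mul_eq_iff_eq_mul₀ hs0] at h1
  rw [h1]
  linear_combination -fourierY (b.repr.symm ⟨_, hmem⟩) n * hs2'

namespace HY

noncomputable instance (d s : ℕ) : InnerProductSpace ℂ (HY d s) where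
  inner u v := ⟪toSeq u, toSeq v⟫
  norm_sq_eq_re_inner u := norm_sq_eq_re_inner (𝕜 := ℂ) (toSeq u)
  conj_inner_symm u v := inner_conj_symm (toSeq u) (toSeq v)
  add_left u v w := by simp
  smul_left u v r := by simp [mul_comm]

theorem hasSum_norm_sq {s : ℕ} (u : HY d s) :
    HasSum (fun n => sobolevWeight s n * ‖fourierY (toL2 u) n‖ ^ 2) (‖u‖ ^ 2) := by
  have hu : Summable fun n => sobolevWeight s n * ‖fourierY (toL2 u) n‖ ^ 2 := u.2
  rw [norm_eq, sobolevNorm, Real.sq_sqrt (tsum_nonneg fun n =>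
    mul_nonneg (sobolevWeight_pos s n).le (by positivity))]
  exact hu.hasSum

theorem toL2_injective {s : ℕ} : Function.Injective (toL2 (d := d) (s := s)) :=
  Subtype.val_injective

theorem one_le_sobolevWeight (s : ℕ) (n : Fin d → ℤ) : 1 ≤ sobolevWeight s n := by
  unfold sobolevWeight
  have h : 0 ≤ ∑ j, (n j : ℝ) ^ 2 := Finset.sum_nonneg fun j _ => sq_nonneg _
  exact one_le_pow₀ (by linarith)

/-- Riesz–Fischer applied to the unweighted coefficients. It identifies `HY d s` with `ℓ²` and so
provides the completeness on which adjoints and the implicit function theorem rely. -/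
theorem toSeq_surjective {s : ℕ} : Function.Surjective (toSeq (d := d) (s := s)) := by
  intro a
  have hw (n : Fin d → ℤ) : (√(sobolevWeight s n) : ℂ) ≠ 0 := by
    exact_mod_cast (Real.sqrt_pos.2 (sobolevWeight_pos s n)).ne'
  have ha : Summable fun n => ‖a n‖ ^ 2 := by
    simpa using (lp.memℓp a).summable (by norm_num)
  obtain ⟨u, hu⟩ := exists_fourierY_eq (a := fun n => (√(sobolevWeight s n) : ℂ)⁻¹ * a n) (by
    refine Summable.of_nonneg_of_le (fun n => by positivity) (fun n => ?_) ha
    rw [norm_mul, mul_pow, norm_inv, Complex.norm_real, Real.norm_eq_abs, inv_pow, sq_abs,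
      Real.sq_sqrt (sobolevWeight_pos s n).le]
    exact mul_le_of_le_one_left (by positivity) (inv_le_one_of_one_le₀ (one_le_sobolevWeight s n)))
  have hus : Summable fun n => sobolevWeight s n * ‖fourierY u n‖ ^ 2 := by
    refine ha.congr fun n => ?_
    rw [hu, norm_mul, mul_pow, norm_inv, Complex.norm_real, Real.norm_eq_abs, inv_pow, sq_abs,
      Real.sq_sqrt (sobolevWeight_pos s n).le, mul_inv_cancel_left₀ (sobolevWeight_pos s n).ne']
  refine ⟨⟨u, hus⟩, ?_⟩
  ext n
  change (√(sobolevWeight s n) : ℂ) * fourierY u n = a n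
  rw [hu, mul_inv_cancel_left₀ (hw n)]

instance (d s : ℕ) : CompleteSpace (HY d s) := by
  let e : HY d s ≃ₗᵢ[ℂ] lp (fun _ : Fin d → ℤ => ℂ) 2 :=
    ⟨LinearEquiv.ofBijective toSeq ⟨toSeq_injective, toSeq_surjective⟩, fun u => rfl⟩
  exact e.toIsometryEquiv.completeSpace

/-- Fourier multipliers of order at most `s` map `H^s_♯(Y)` to `L²_♯(Y)`. -/
theorem exists_multiplier {s : ℕ} {m : (Fin d → ℤ) → ℂ}
    (hm : ∀ n, ‖m n‖ ^ 2 ≤ sobolevWeight s n) :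
    ∃ T : HY d s →L[ℂ] L2Y d, ∀ u n, fourierY (T u) n = m n * fourierY (toL2 u) n := by
  have hle (u : HY d s) (n : Fin d → ℤ) : ‖m n * fourierY (toL2 u) n‖ ^ 2 ≤
      sobolevWeight s n * ‖fourierY (toL2 u) n‖ ^ 2 := by
    rw [norm_mul, mul_pow]
    gcongr
    exact hm n
  have hex (u : HY d s) : ∃ g : L2Y d, ∀ n, fourierY g n = m n * fourierY (toL2 u) n :=
    exists_fourierY_eq (Summable.of_nonneg_of_le (fun n => by positivity) (hle u)
      (hasSum_norm_sq u).summable)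
  choose T hT using hex
  let T' : HY d s →ₗ[ℂ] L2Y d :=
    { toFun := T
      map_add' := fun u v => fourierY_ext fun n => by
        simp only [fourierY_add, hT, map_add, mul_add]
      map_smul' := fun c u => fourierY_ext fun n => by
        simp only [fourierY_smul, hT, map_smul, RingHom.id_apply]
        ring }
  refine ⟨T'.mkContinuous √(volY d) fun u => ?_, hT⟩
  refine (sq_le_sq₀ (norm_nonneg _) (by positivity)).1 ?_
  rw [mul_pow, Real.sq_sqrt (volY_pos d).le]
  refine hasSum_le (fun n => ?_) (BlochWave.hasSum_norm_sq _) ((hasSum_norm_sq u).mul_left _)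
  have := hle u n
  rw [← hT] at this
  exact mul_le_mul_of_nonneg_left this (volY_pos d).le

/-- The Fourier multiplier with symbol `m`. -/
noncomputable def multiplier {s : ℕ} (m : (Fin d → ℤ) → ℂ)
    (hm : ∀ n, ‖m n‖ ^ 2 ≤ sobolevWeight s n) : HY d s →L[ℂ] L2Y d :=
  (exists_multiplier hm).choose

@[simp]
theorem fourierY_multiplier {s : ℕ} (m : (Fin d → ℤ) → ℂ)
    (hm : ∀ n, ‖m n‖ ^ 2 ≤ sobolevWeight s n) (u : HY d s) (n : Fin d → ℤ) :
    fourierY (multiplier m hm u) n = m n * fourierY (toL2 u) n :=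
  (exists_multiplier hm).choose_spec u n

end HY

end BlochWave
end

/-! ### The Bloch problem as an instance of the abstract setting. -/

section
namespace BlochWave

variable {d : ℕ}

local notation "⟪" x ", " y "⟫" => inner ℂ x y

theorem pderivY_eq {j : Fin d} {u g : L2Y d}
    (h : ∀ n, fourierY g n = Complex.I * (n j : ℂ) * fourierY u n) : pderivY j u = g := by
  have hex : ∃ g : L2Y d, ∀ n, fourierY g n = Complex.I * (n j : ℂ) * fourierY u n := ⟨g, h⟩
  rw [pderivY, dif_pos hex]
  exact fourierY_ext fun n => by rw [hex.choose_spec, h]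

theorem sq_le_sum_sq (n : Fin d → ℤ) (j : Fin d) : (n j : ℝ) ^ 2 ≤ ∑ j, (n j : ℝ) ^ 2 :=
  Finset.single_le_sum (f := fun j => (n j : ℝ) ^ 2) (fun _ _ => sq_nonneg _) (Finset.mem_univ j)

theorem sum_sq_nonneg (n : Fin d → ℤ) : 0 ≤ ∑ j, (n j : ℝ) ^ 2 :=
  Finset.sum_nonneg fun _ _ => sq_nonneg _

theorem norm_neg_sum_sq (n : Fin d → ℤ) :
    ‖-∑ j, (n j : ℂ) ^ 2‖ = ∑ j, (n j : ℝ) ^ 2 := by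
  rw [norm_neg]
  have : (∑ j, (n j : ℂ) ^ 2) = ((∑ j, (n j : ℝ) ^ 2 : ℝ) : ℂ) := by push_cast; rfl
  rw [this, Complex.norm_real, Real.norm_of_nonneg (sum_sq_nonneg n)]

namespace HY

/-- The inclusion of `H²_♯(Y)` in `L²_♯(Y)`. -/
noncomputable def inclL : HY d 2 →L[ℂ] L2Y d :=
  multiplier (fun _ => 1) fun n => by simpa using one_le_sobolevWeight 2 n

/-- The partial derivatives on `H²_♯(Y)`. -/
noncomputable def gradL (j : Fin d) : HY d 2 →L[ℂ] L2Y d :=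
  multiplier (fun n => Complex.I * (n j : ℂ)) fun n => by
    have h1 := sq_le_sum_sq n j
    have h2 := sum_sq_nonneg n
    simp only [norm_mul, Complex.norm_I, one_mul, Complex.norm_intCast, sq_abs, sobolevWeight]
    nlinarith

/-- The second partial derivatives on `H²_♯(Y)`. -/
noncomputable def hessL (j : Fin d) : HY d 2 →L[ℂ] L2Y d :=
  multiplier (fun n => -(n j : ℂ) ^ 2) fun n => by
    have h1 := sq_le_sum_sq n j
    simp only [norm_neg, norm_pow, Complex.norm_intCast, sq_abs, sobolevWeight]
    gcongr
    linarith

/-- The Laplacian on `H²_♯(Y)`. -/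
noncomputable def lapL : HY d 2 →L[ℂ] L2Y d :=
  multiplier (fun n => -∑ j, (n j : ℂ) ^ 2) fun n => by
    rw [norm_neg_sum_sq, sobolevWeight]
    have := sum_sq_nonneg n
    gcongr
    linarith

theorem inclL_apply (u : HY d 2) : inclL u = toL2 u :=
  fourierY_ext fun n => by simp [inclL]

theorem pderivY_toL2 (j : Fin d) (u : HY d 2) : pderivY j (toL2 u) = gradL j u :=
  pderivY_eq fun n => by simp [gradL]

theorem pderivY_gradL (j : Fin d) (u : HY d 2) (c : ℂ) :
    pderivY j (gradL j u + c • toL2 u) = hessL j u + c • gradL j u :=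
  pderivY_eq fun n => by
    simp only [gradL, hessL, fourierY_add, fourierY_smul, fourierY_multiplier]
    linear_combination -(n j : ℂ) ^ 2 * fourierY (toL2 u) n * Complex.I_sq

end HY

open HY

/-- Multiplication by a bounded real function. -/
noncomputable def mulL {a : (Fin d → ℝ) → ℝ} (ha : MemLp (fun y => (a y : ℂ)) ∞ (muY d)) :
    L2Y d →L[ℂ] L2Y d :=
  (ContinuousLinearMap.mul ℂ ℂ).holderL (muY d) ∞ 2 2 ha.toLp

theorem coeFn_mulL {a : (Fin d → ℝ) → ℝ} (ha : MemLp (fun y => (a y : ℂ)) ∞ (muY d)) (u : L2Y d) :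
    mulL ha u =ᵐ[muY d] fun y => (a y : ℂ) * u y := by
  have h := (ContinuousLinearMap.mul ℂ ℂ).coeFn_holder (r := 2) ha.toLp u
  filter_upwards [h, ha.coeFn_toLp] with y h1 h2
  rw [h2] at h1
  exact h1

section Coefficients

variable {A : (Fin d → ℝ) → Matrix (Fin d) (Fin d) ℝ}

theorem IsPeriodicElliptic.memLp (hA : IsPeriodicElliptic A) (j k : Fin d) :
    MemLp (fun y => (A y j k : ℂ)) ∞ (muY d) := by
  obtain ⟨M, hM⟩ := hA.bounded
  refine memLp_top_of_bound (Complex.measurable_ofReal.comp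
    (hA.measurable j k)).aestronglyMeasurable M ?_
  filter_upwards [ae_restrict_of_ae (hM j k)] with y hy
  simpa using hy

/-- The operators of the Bloch problem with coefficients `A`. -/
noncomputable def blochData (hA : IsPeriodicElliptic A) : FormData d (HY d 2) (L2Y d) where
  incl := inclL
  grad := gradL
  lap := lapL
  coef j k := mulL (hA.memLp j k)

variable (hA : IsPeriodicElliptic A)
include hA

theorem gradOp_blochData (η : Fin d → ℝ) (j : Fin d) (u : HY d 2) :
    (blochData hA).gradOp η j u = shiftGrad η j (toL2 u) := by
  simp [FormData.gradOp, shiftGrad, blochData, pderivY_toL2, inclL_apply]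

/-- Expanding `(∂ⱼ + i ηⱼ)²` is legitimate on `H²`: both derivatives exist in `L²`, so the default
value in `pderivY` is never taken. -/
theorem lapOp_blochData (η : Fin d → ℝ) (u : HY d 2) :
    (blochData hA).lapOp η u = shiftLaplacian η (toL2 u) := by
  have h1 (j : Fin d) : shiftGrad η j (shiftGrad η j (toL2 u)) =
      hessL j u + (2 * Complex.I * (η j : ℂ)) • gradL j u - ((η j : ℂ) ^ 2) • inclL u := by
    have h2 : (Complex.I * (η j : ℂ)) * (Complex.I * (η j : ℂ)) = -(η j : ℂ) ^ 2 := by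
      linear_combination (η j : ℂ) ^ 2 * Complex.I_sq
    simp only [shiftGrad, pderivY_toL2, pderivY_gradL, inclL_apply, smul_add, smul_smul, h2]
    module
  have h3 : lapL u = ∑ j, hessL j u := fourierY_ext fun n => by
    rw [fourierY_sum]
    simp [lapL, hessL, Finset.sum_mul]
  simp only [shiftLaplacian, h1, Finset.sum_sub_distrib, Finset.sum_add_distrib, ← h3]
  simp [FormData.lapOp, blochData, Finset.sum_smul]

theorem inner_coef (x y : L2Y d) (j k : Fin d) :
    ⟪x, (blochData hA).coef j k y⟫ = ∫ t in cellY d, (A t j k : ℂ) * y t * conj (x t) := by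
  rw [L2.inner_def]
  refine integral_congr_ae ?_
  filter_upwards [coeFn_mulL (hA.memLp j k) y] with t ht
  simp only [blochData]
  rw [ht, RCLike.inner_apply]

theorem integrable_coef (x y : L2Y d) (j k : Fin d) :
    Integrable (fun t => (A t j k : ℂ) * y t * conj (x t)) (muY d) := by
  refine (L2.integrable_inner (𝕜 := ℂ) x (mulL (hA.memLp j k) y)).congr ?_
  filter_upwards [coeFn_mulL (hA.memLp j k) y] with t ht
  rw [ht, RCLike.inner_apply]

theorem sum_inner_coef (ξ ζ : Fin d → L2Y d) :
    ∑ j, ⟪ζ j, ∑ k, (blochData hA).coef j k (ξ k)⟫ =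
      ∫ y in cellY d, ∑ j, (∑ k, (A y j k : ℂ) * ξ k y) * conj (ζ j y) := by
  simp only [inner_sum, inner_coef, Finset.sum_mul]
  rw [integral_finsetSum _ fun j _ =>
    integrable_finsetSum _ fun k _ => integrable_coef hA _ _ j k]
  refine Finset.sum_congr rfl fun j _ => ?_
  rw [integral_finsetSum _ fun k _ => integrable_coef hA _ _ j k]

theorem form_blochData (ρ : ℝ) (η : Fin d → ℝ) (u v : HY d 2) :
    (blochData hA).form ρ η u v = blochForm A ρ η (toL2 u) (toL2 v) := by
  simp only [FormData.form, sum_inner_coef, blochForm, gradOp_blochData, lapOp_blochData]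
  rw [L2.inner_def]
  rfl

theorem coefSymm_blochData : (blochData hA).CoefSymm := by
  intro j k x y
  rw [← inner_conj_symm ((blochData hA).coef k j x) y, inner_coef, inner_coef, ← integral_conj]
  refine integral_congr_ae ?_
  filter_upwards [ae_restrict_of_ae hA.symm] with t ht
  have : A t j k = A t k j := ht.apply k j
  simp only [map_mul, Complex.conj_ofReal, Complex.conj_conj, this]
  ring

/-- Since `A` is real, the real part of the Hermitian expression splits into the quadratic forms of
the real and imaginary parts of `ξ`, each nonnegative by ellipticity. -/
theorem coefNonneg_blochData : (blochData hA).CoefNonneg := by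
  intro ξ
  obtain ⟨α, hα, hell⟩ := hA.elliptic
  have hint : Integrable (fun y => ∑ j, (∑ k, (A y j k : ℂ) * ξ k y) * conj (ξ j y)) (muY d) := by
    simp only [Finset.sum_mul]
    exact integrable_finsetSum _ fun j _ => integrable_finsetSum _ fun k _ =>
      integrable_coef hA _ _ j k
  rw [sum_inner_coef]
  change 0 ≤ Complex.reCLM _
  rw [← Complex.reCLM.integral_comp_comm hint]
  refine integral_nonneg_of_ae ?_
  filter_upwards [ae_restrict_of_ae hell] with y hy
  have h1 := hy fun j => (ξ j y).re
  have h2 := hy fun j => (ξ j y).im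
  have h3 : (∑ j, (∑ k, (A y j k : ℂ) * ξ k y) * conj (ξ j y)).re =
      ∑ j, (∑ k, A y j k * (ξ k y).re) * (ξ j y).re +
        ∑ j, (∑ k, A y j k * (ξ k y).im) * (ξ j y).im := by
    rw [← Finset.sum_add_distrib, Complex.re_sum]
    refine Finset.sum_congr rfl fun j _ => ?_
    simp [Complex.mul_re]
  have h4 : ∀ z : Fin d → ℝ, 0 ≤ α * ∑ j, z j ^ 2 := fun z =>
    mul_nonneg hα.le (Finset.sum_nonneg fun _ _ => sq_nonneg _)
  change 0 ≤ (∑ j, (∑ k, (A y j k : ℂ) * ξ k y) * conj (ξ j y)).re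
  rw [h3]
  linarith [h4 fun j => (ξ j y).re, h4 fun j => (ξ j y).im]

end Coefficients

/-- The constant function `1`. -/
noncomputable def constY (d : ℕ) : HY d 2 :=
  ⟨expL2 0, by
    refine summable_of_ne_finset_zero (s := {0}) fun n hn => ?_
    rw [Finset.mem_singleton] at hn
    simp [fourierY_expL2, hn]⟩

theorem toL2_constY : toL2 (constY d) = expL2 0 := rfl

theorem fourierY_eq_inner (n : Fin d → ℤ) (u : L2Y d) :
    fourierY u n = (volY d : ℂ)⁻¹ * ⟪expL2 n, u⟫ := by
  rw [inner_expL2, inv_mul_cancel_left₀]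
  exact_mod_cast (volY_pos d).ne'

/-- The subspace of functions of mean value zero in `H²_♯(Y)`. -/
noncomputable def meanZero (d : ℕ) : Submodule ℂ (HY d 2) :=
  (innerSL ℂ (expL2 (0 : Fin d → ℤ)) ∘L inclL).ker

theorem mem_meanZero {u : HY d 2} : u ∈ meanZero d ↔ fourierY (toL2 u) 0 = 0 := by
  rw [meanZero, LinearMap.mem_ker]
  change ⟪expL2 0, inclL u⟫ = 0 ↔ _
  rw [inner_expL2, inclL_apply]
  have : (volY d : ℂ) ≠ 0 := by exact_mod_cast (volY_pos d).ne'
  simp [this]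

instance : CompleteSpace (meanZero d) :=
  (ContinuousLinearMap.isClosed_ker _).completeSpace_coe

theorem meanY_toL2 (u : L2Y d) : meanY (u : (Fin d → ℝ) → ℂ) = fourierY u 0 := by
  simp [fourierY, expY_zero]

/-- The symbols `i nⱼ` and `-|n|²` vanish at `n = 0`. Hence constants are annihilated, and
derivatives have mean value zero. -/
theorem isAdmissible_blochData {A : (Fin d → ℝ) → Matrix (Fin d) (Fin d) ℝ}
    (hA : IsPeriodicElliptic A) : (blochData hA).IsAdmissible (meanZero d) (constY d) := by
  have hincl (u : HY d 2) : (blochData hA).incl u = toL2 u := inclL_apply u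
  have hc : (blochData hA).incl (constY d) = expL2 0 := hincl _
  refine ⟨coefNonneg_blochData hA, coefSymm_blochData hA, fun j => ?_, ?_, ?_, ?_, ?_, ?_, ?_, ?_,
    ?_⟩
  · refine fourierY_ext fun n => ?_
    have h0 : fourierY (0 : L2Y d) n = 0 := by simpa using fourierY_smul 0 (0 : L2Y d) n
    simp only [blochData, gradL, fourierY_multiplier, h0, toL2_constY, fourierY_expL2]
    split_ifs with hn
    · simp [hn]
    · simp
  · refine fourierY_ext fun n => ?_
    have h0 : fourierY (0 : L2Y d) n = 0 := by simpa using fourierY_smul 0 (0 : L2Y d) n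
    simp only [blochData, lapL, fourierY_multiplier, h0, toL2_constY, fourierY_expL2]
    split_ifs with hn
    · simp [hn]
    · simp
  · intro h
    have h1 := fourierY_expL2 (0 : Fin d → ℤ) 0
    rw [← toL2_constY, h, map_zero, fourierY_eq_inner, inner_zero_right] at h1
    simp at h1
  · intro u v huv
    rw [hincl, hincl] at huv
    exact toL2_injective huv
  · intro x hx
    rw [hc, hincl, inner_expL2, mem_meanZero.1 hx, mul_zero]
  · intro x hx j
    rw [hc, inner_expL2]
    simp [blochData, gradL]
  · intro x hx
    rw [hc, inner_expL2]
    simp [blochData, lapL]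
  · intro w
    refine ⟨fourierY (toL2 w) 0, w - fourierY (toL2 w) 0 • constY d, ?_, by abel⟩
    rw [mem_meanZero, sub_eq_add_neg, ← neg_smul, map_add, map_smul, fourierY_add, fourierY_smul,
      toL2_constY, fourierY_expL2]
    simp
  -- For `n ≠ 0` one has `|n|² ≥ 1`, so `(1 + |n|²)² ≤ 4 |n|⁴`, which is the factor `1/2`; `√|Y|`
  -- converts coefficient sums into the `L²` norm.
  · refine ⟨√(volY d) / 2, half_pos (Real.sqrt_pos.2 (volY_pos d)), fun x => ?_⟩
    refine (sq_le_sq₀ (by positivity) (norm_nonneg _)).1 ?_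
    rw [mul_pow, div_pow, Real.sq_sqrt (volY_pos d).le]
    change volY d / 2 ^ 2 * ‖(x : HY d 2)‖ ^ 2 ≤ ‖lapL (x : HY d 2)‖ ^ 2
    refine hasSum_le (fun n => ?_) ((HY.hasSum_norm_sq (x : HY d 2)).mul_left _) (hasSum_norm_sq _)
    rcases eq_or_ne n 0 with rfl | hn
    · rw [mem_meanZero.1 x.2]
      simpa using mul_nonneg (volY_pos d).le (sq_nonneg _)
    · have h1 : 1 ≤ ∑ j, (n j : ℝ) ^ 2 := by
        obtain ⟨j, hj⟩ := Function.ne_iff.1 hn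
        refine le_trans ?_ (sq_le_sum_sq n j)
        have hj' : n j ≠ 0 := hj
        have : 0 < (n j) ^ 2 := by positivity
        have : 1 ≤ (n j) ^ 2 := this
        exact_mod_cast this
      rw [lapL, fourierY_multiplier, norm_mul, mul_pow, norm_neg_sum_sq, sobolevWeight,
        div_mul_eq_mul_div, mul_div_assoc]
      refine mul_le_mul_of_nonneg_left ?_ (volY_pos d).le
      rw [mul_div_right_comm]
      refine mul_le_mul_of_nonneg_right ?_ (sq_nonneg _)
      nlinarith

end BlochWave
end

/-! ### Parity of the first eigenvalue and its expansion in powers of `ε`. -/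

section
open scoped ContDiff
namespace BlochWave

variable {d : ℕ}

local notation "⟪" x ", " y "⟫" => inner ℂ x y

theorem fourierY_star (u : L2Y d) (n : Fin d → ℤ) :
    fourierY (star u) n = conj (fourierY u (-n)) := by
  have h : ∫ y in cellY d, (star u : L2Y d) y * conj (expY n y) =
      conj (∫ y in cellY d, u y * conj (expY (-n) y)) := by
    rw [← integral_conj]
    refine integral_congr_ae ?_
    filter_upwards [Lp.coeFn_star u] with y hy
    rw [hy, map_mul, Complex.conj_conj, conj_expY]
    rfl
  unfold fourierY meanY
  rw [h, Complex.real_smul, Complex.real_smul, map_mul, Complex.conj_ofReal]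

/-- Complex conjugation on `H²_♯(Y)`. -/
noncomputable def HY.conjugate (u : HY d 2) : HY d 2 :=
  ⟨star (HY.toL2 u), by
    have hu := ((Equiv.neg (Fin d → ℤ)).summable_iff).2 (HY.hasSum_norm_sq u).summable
    refine hu.congr fun n => ?_
    simp [fourierY_star, sobolevWeight]⟩

theorem HY.toL2_conjugate (u : HY d 2) : HY.toL2 (HY.conjugate u) = star (HY.toL2 u) := rfl

theorem HY.conjugate_conjugate (u : HY d 2) : HY.conjugate (HY.conjugate u) = u :=
  HY.toL2_injective (by simp [HY.toL2_conjugate])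

theorem fourierY_shiftGrad (η : Fin d → ℝ) (j : Fin d) (u : HY d 2) (n : Fin d → ℤ) :
    fourierY (shiftGrad η j (HY.toL2 u)) n =
      Complex.I * ((n j : ℂ) + (η j : ℂ)) * fourierY (HY.toL2 u) n := by
  rw [shiftGrad, HY.pderivY_toL2, fourierY_add, fourierY_smul, HY.gradL, HY.fourierY_multiplier]
  ring

theorem shiftGrad_conjugate (η : Fin d → ℝ) (j : Fin d) (u : HY d 2) :
    shiftGrad (-η) j (HY.toL2 (HY.conjugate u)) = star (shiftGrad η j (HY.toL2 u)) :=
  fourierY_ext fun n => by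
    rw [fourierY_star, fourierY_shiftGrad, fourierY_shiftGrad, HY.toL2_conjugate, fourierY_star]
    simp
    ring

section Eigenvalues

variable {A : (Fin d → ℝ) → Matrix (Fin d) (Fin d) ℝ} (hA : IsPeriodicElliptic A)
include hA

theorem fourierY_shiftLaplacian (η : Fin d → ℝ) (u : HY d 2) (n : Fin d → ℤ) :
    fourierY (shiftLaplacian η (HY.toL2 u)) n =
      -(∑ j, ((n j : ℂ) + (η j : ℂ)) ^ 2) * fourierY (HY.toL2 u) n := by
  have h1 : (blochData hA).lapOp η u = HY.lapL u +
      ∑ j, (2 * Complex.I * (η j : ℂ)) • HY.gradL j u +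
        (-∑ j, (η j : ℂ) ^ 2) • HY.toL2 u := by
    simp [FormData.lapOp, blochData, HY.inclL_apply, sub_eq_add_neg]
  rw [← lapOp_blochData hA, h1, fourierY_add, fourierY_add, fourierY_sum]
  simp only [fourierY_smul, HY.lapL, HY.gradL, HY.fourierY_multiplier, add_sq,
    Finset.sum_add_distrib, neg_mul, Finset.sum_mul, add_mul]
  have h2 : ∀ j, 2 * Complex.I * (η j : ℂ) * (Complex.I * (n j : ℂ) * fourierY (HY.toL2 u) n) =
      -(2 * (n j : ℂ) * (η j : ℂ) * fourierY (HY.toL2 u) n) := fun j => by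
    linear_combination 2 * (n j : ℂ) * (η j : ℂ) * fourierY (HY.toL2 u) n * Complex.I_sq
  simp only [h2, Finset.sum_neg_distrib]
  ring

theorem shiftLaplacian_conjugate (η : Fin d → ℝ) (u : HY d 2) :
    shiftLaplacian (-η) (HY.toL2 (HY.conjugate u)) = star (shiftLaplacian η (HY.toL2 u)) :=
  fourierY_ext fun n => by
    rw [fourierY_star, fourierY_shiftLaplacian hA, fourierY_shiftLaplacian hA, HY.toL2_conjugate,
      fourierY_star]
    simp only [map_mul, map_neg, map_sum, map_pow, map_add, Complex.conj_ofReal, map_intCast,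
      Pi.neg_apply, Complex.ofReal_neg, Int.cast_neg]
    congr 2
    exact Finset.sum_congr rfl fun j _ => by ring

theorem blochForm_conjugate (ρ : ℝ) (η : Fin d → ℝ) (u v : HY d 2) :
    blochForm A ρ (-η) (HY.toL2 (HY.conjugate u)) (HY.toL2 (HY.conjugate v)) =
      conj (blochForm A ρ η (HY.toL2 u) (HY.toL2 v)) := by
  simp only [blochForm, shiftGrad_conjugate, shiftLaplacian_conjugate hA, map_add, map_mul,
    ← integral_conj, map_pow, Complex.conj_ofReal]
  have hae : ∀ᵐ y ∂(muY d), (∀ j, (star (shiftGrad η j (HY.toL2 u)) : L2Y d) y =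
      conj (shiftGrad η j (HY.toL2 u) y)) ∧ ∀ j, (star (shiftGrad η j (HY.toL2 v)) : L2Y d) y =
      conj (shiftGrad η j (HY.toL2 v) y) :=
    (ae_all_iff.2 fun j => Lp.coeFn_star _).and (ae_all_iff.2 fun j => Lp.coeFn_star _)
  congr 1
  · refine integral_congr_ae ?_
    filter_upwards [hae] with y hy
    simp only [hy.1, hy.2, map_sum, map_mul, Complex.conj_ofReal]
  · congr 1
    refine integral_congr_ae ?_
    filter_upwards [Lp.coeFn_star (shiftLaplacian η (HY.toL2 u)),
      Lp.coeFn_star (shiftLaplacian η (HY.toL2 v))] with y h1 h2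
    rw [h1, h2]
    simp

/-- The coefficients and the eigenvalue are real, so conjugating the weak equation merely changes `i
η` into `-i η`; every test function is itself a conjugate. -/
theorem isBlochEigenfunction_conjugate {ρ : ℝ} {η : Fin d → ℝ} {lam : ℝ} {φ : HY d 2}
    (h : IsBlochEigenfunction A ρ η lam φ) :
    IsBlochEigenfunction A ρ (-η) lam (HY.conjugate φ) := by
  refine ⟨fun h0 => h.1 ?_, fun v => ?_⟩
  · rw [← HY.conjugate_conjugate φ, h0]
    refine HY.toL2_injective ?_
    rw [HY.toL2_conjugate, map_zero]
    refine fourierY_ext fun n => ?_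
    have h0 (n : Fin d → ℤ) : fourierY (0 : L2Y d) n = 0 := by
      simpa using fourierY_smul 0 (0 : L2Y d) n
    rw [fourierY_star, h0, h0, map_zero]
  · obtain ⟨v, rfl⟩ : ∃ w, v = HY.conjugate w := ⟨_, (HY.conjugate_conjugate v).symm⟩
    rw [blochForm_conjugate hA, h.2, map_mul, Complex.conj_ofReal, ← integral_conj]
    congr 1
    refine integral_congr_ae ?_
    filter_upwards [Lp.coeFn_star (HY.toL2 φ), Lp.coeFn_star (HY.toL2 v)] with y h1 h2
    rw [HY.toL2_conjugate, HY.toL2_conjugate, h1, h2]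
    simp

/-- The first Bloch eigenvalue is an even function. -/
theorem firstEigenvalue_neg (ρ : ℝ) (η : Fin d → ℝ) :
    firstEigenvalue A ρ (-η) = firstEigenvalue A ρ η := by
  have h : ∀ η, blochEigenvalues A ρ η ⊆ blochEigenvalues A ρ (-η) := fun η lam ⟨φ, hφ⟩ =>
    ⟨_, isBlochEigenfunction_conjugate hA hφ⟩
  have h' := h (-η)
  rw [neg_neg] at h'
  rw [firstEigenvalue, firstEigenvalue, h'.antisymm (h η)]

/-- Evenness holds for the eigenvalue sets at all `η`, so neither analyticity of the eigenvalue nor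
a restriction on `ρ` enters. -/
theorem eigenvalueDeriv_eq_zero_of_odd (ρ : ℝ) {β : Fin d → ℕ} (hβ : Odd (∑ j, β j)) :
    eigenvalueDeriv A ρ β = 0 := by
  rw [eigenvalueDeriv, multiPartial_eq_iterPartial]
  refine iterPartial_eq_zero_of_dilation (t := -1) (s := 1)
    (Eventually.of_forall fun η => ?_) ?_
  · rw [neg_one_smul, one_smul, firstEigenvalue_neg hA]
  · rw [length_indexList, hβ.neg_one_pow]
    norm_num

theorem isBlochEigenfunction_iff {ρ : ℝ} {η : Fin d → ℝ} {lam : ℝ} {φ : HY d 2} :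
    IsBlochEigenfunction A ρ η lam φ ↔ (blochData hA).IsEigenvector ρ η lam φ := by
  have h (v : HY d 2) : ⟪(blochData hA).incl v, (blochData hA).incl φ⟫ =
      ∫ y in cellY d, HY.toL2 φ y * conj (HY.toL2 v y) := by
    change ⟪HY.inclL v, HY.inclL φ⟫ = _
    rw [HY.inclL_apply, HY.inclL_apply, L2.inner_def]
    rfl
  simp only [IsBlochEigenfunction, FormData.IsEigenvector, form_blochData, h]

theorem incl_constY : (blochData hA).incl (constY d) = expL2 0 := HY.inclL_apply _

theorem norm_sq_incl_constY : ‖(blochData hA).incl (constY d)‖ ^ 2 = volY d := by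
  rw [incl_constY, ← @inner_self_eq_norm_sq ℂ, inner_expL2, fourierY_expL2]
  simp

theorem inner_coef_constY (j k : Fin d) :
    ⟪expL2 0, (blochData hA).coef j k (expL2 0)⟫ =
      ((volY d * meanY (fun y => A y j k) : ℝ) : ℂ) := by
  rw [inner_coef, meanY, smul_eq_mul, ← volY, mul_inv_cancel_left₀ (volY_pos d).ne',
    ← integral_complex_ofReal]
  refine integral_congr_ae ?_
  filter_upwards [coeFn_expL2 (0 : Fin d → ℤ)] with y hy
  rw [hy, expY_zero]
  simp

end Eigenvalues

/-- The normalizing constant `(2π)^{-d/2}`. -/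
noncomputable def normConst (d : ℕ) : ℝ := (2 * Real.pi) ^ (-(d : ℝ) / 2)

theorem normConst_pos (d : ℕ) : 0 < normConst d := by
  unfold normConst
  positivity

/-- The effective quadratic part of the first Bloch eigenvalue. -/
noncomputable def meanQuadratic (A : (Fin d → ℝ) → Matrix (Fin d) (Fin d) ℝ) (η : Fin d → ℝ) : ℝ :=
  ∑ j, ∑ k, meanY (fun y => A y j k) * (η j * η k)

/-- The Bloch eigenvalue of the pure fourth order operator at the constant mode. -/
def quarticSymbol (η : Fin d → ℝ) : ℝ := (∑ j, η j ^ 2) ^ 2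

/-- The flux is affine in `ε` for fixed `χ`, and its constant part contributes the averaged
coefficients. The explicit factor `ε ^ 2` in front of the corrector term still leaves one `ε` after
multiplication by `ρ²`. -/
theorem re_scaledEigenvalue {A : (Fin d → ℝ) → Matrix (Fin d) (Fin d) ℝ}
    (hA : IsPeriodicElliptic A) (η : Fin d → ℝ) (ε : ℝ) (χ : meanZero d) :
    (((blochData hA).restrict (meanZero d)).scaledEigenvalue (expL2 0) η ε χ).re =
      quarticSymbol η + ε * meanQuadratic A η + ε ^ 2 * ((volY d)⁻¹ *
        (((blochData hA).restrict (meanZero d)).correctorFlux (expL2 0) η χ).re) := by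
  set F := (blochData hA).restrict (meanZero d)
  set o : L2Y d := expL2 0
  have hv := volY_pos d
  have hnorm : ‖o‖ ^ 2 = volY d := by
    have := norm_sq_incl_constY hA
    rwa [incl_constY] at this
  have h1 (ε : ℝ) : ∑ j, ⟪(Complex.I * (η j : ℂ)) • o, F.flux o η ε χ j⟫ =
      ((volY d * meanQuadratic A η : ℝ) : ℂ) +
        ε * ∑ j, ∑ k, ⟪(Complex.I * (η j : ℂ)) • o, F.coef j k (F.gradOp η k χ)⟫ := by
    simp only [FormData.flux, map_add, map_smul, inner_sum, inner_add_right,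
      Finset.sum_add_distrib, Finset.mul_sum, inner_smul_right]
    congr 1
    rw [meanQuadratic, Finset.mul_sum, Complex.ofReal_sum]
    refine Finset.sum_congr rfl fun j _ => ?_
    rw [Finset.mul_sum, Complex.ofReal_sum]
    refine Finset.sum_congr rfl fun k _ => ?_
    rw [inner_smul_left, show ⟪o, F.coef j k o⟫ = _ from inner_coef_constY hA j k]
    simp only [map_mul, Complex.conj_I, Complex.conj_ofReal]
    push_cast
    linear_combination -(η j : ℂ) * η k * volY d * (meanY fun y => A y j k : ℝ) * Complex.I_sq
  have h4 : (∑ j, (η j : ℂ) ^ 2) ^ 2 = ((quarticSymbol η : ℝ) : ℂ) := by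
    simp [quarticSymbol]
  rw [FormData.scaledEigenvalue, FormData.correctorFlux, h1, h1, h1, h4, hnorm, Complex.add_re, Complex.re_ofReal_mul,
    Complex.ofReal_re, Complex.add_re, Complex.ofReal_re, Complex.re_ofReal_mul]
  simp only [Complex.ofReal_one, one_mul, Complex.ofReal_zero, zero_mul, add_zero,
    add_sub_cancel_left]
  field_simp
  ring

end BlochWave
end

/-! ### The analytic ground state and bounds uniform in `ρ`. -/

section
open scoped ContDiff
namespace BlochWave

variable {d : ℕ}

local notation "⟪" x ", " y "⟫" => inner ℂ x y

section Eigenvalues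

variable {A : (Fin d → ℝ) → Matrix (Fin d) (Fin d) ℝ} (hA : IsPeriodicElliptic A)
include hA

/-- The eigenspace is a line, and the mean value of `a • (constY d + x)` is `a`; the normalization
therefore selects exactly one multiple. -/
theorem isNormalizedGroundState_iff {ρ κ : ℝ} {η : Fin d → ℝ}
    (hco : ∀ x ∈ meanZero d, x ≠ 0 → ∀ lam < κ,
      lam * ‖(blochData hA).incl x‖ ^ 2 < ((blochData hA).form ρ η x x).re)
    {x : meanZero d} {lam : ℝ} (hlam : lam < κ)
    (h : (blochData hA).IsEigenvector ρ η lam (constY d + (x : HY d 2))) :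
    IsLeast (blochEigenvalues A ρ η) lam ∧
      ∀ φ, IsNormalizedGroundState A ρ η φ ↔ φ = (normConst d : ℂ) • (constY d + (x : HY d 2)) := by
  have hF := isAdmissible_blochData hA
  have hleast : IsLeast (blochEigenvalues A ρ η) lam := by
    have h1 := hF.isLeast hco hlam h
    simpa only [blochEigenvalues, isBlochEigenfunction_iff hA] using h1
  have hmean (a : ℂ) : meanY (HY.toL2 (a • (constY d + (x : HY d 2))) : (Fin d → ℝ) → ℂ) = a := by
    rw [meanY_toL2, map_smul, map_add, fourierY_smul, fourierY_add, mem_meanZero.1 x.2,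
      toL2_constY, fourierY_expL2]
    simp
  refine ⟨hleast, fun φ => ?_⟩
  have hfirst : firstEigenvalue A ρ η = lam := hleast.csInf_eq
  rw [IsNormalizedGroundState, hfirst, isBlochEigenfunction_iff hA]
  constructor
  · rintro ⟨h1, h2⟩
    obtain ⟨-, a, rfl⟩ := hF.exists_smul_of_isEigenvector hco hlam hlam h h1
    rw [hmean] at h2
    rw [h2, normConst]
  · rintro rfl
    exact ⟨h.smul (by exact_mod_cast (normConst_pos d).ne'), by rw [hmean, normConst]⟩

/-- Near a parameter `(0, ε₀)` the first Bloch eigenpair is given by functions that are analytic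
in `η` and in `ε = ρ⁻²`. -/
theorem exists_analytic_eigenpair {ε₀ : ℝ} (hε₀ : 0 ≤ ε₀) :
    ∃ (h : (Fin d → ℝ) × ℝ → meanZero d) (r : (Fin d → ℝ) × ℝ → ℝ),
      AnalyticAt ℝ h (0, ε₀) ∧ AnalyticAt ℝ r (0, ε₀) ∧
      ∀ᶠ ε in 𝓝 ε₀, AnalyticAt ℝ h (0, ε) ∧ AnalyticAt ℝ r (0, ε) ∧
        ∀ ρ : ℝ, 1 ≤ ρ → (ρ ^ 2)⁻¹ = ε → ∀ᶠ η in 𝓝 (0 : Fin d → ℝ),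
          IsLeast (blochEigenvalues A ρ η)
            (ρ ^ 2 * quarticSymbol η + (meanQuadratic A η + ε * r (η, ε))) ∧
          ∀ φ, IsNormalizedGroundState A ρ η φ ↔
            φ = (normConst d : ℂ) • (constY d + (ε : ℂ) • (h (η, ε) : HY d 2)) := by
  have hF := isAdmissible_blochData hA
  set F := (blochData hA).restrict (meanZero d)
  obtain ⟨h, hh, hres, hzero⟩ := F.exists_branch hF.nonneg hF.lap_bounded_below (expL2 0) hε₀
  let r : (Fin d → ℝ) × ℝ → ℝ := fun p =>
    (volY d)⁻¹ * (F.correctorFlux (expL2 0) p.1 (h p)).re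
  have hr {p : (Fin d → ℝ) × ℝ} (hp : AnalyticAt ℝ h p) : AnalyticAt ℝ r p :=
    F.analyticAt_correctorFlux (expL2 0) hp _
  have hsE (p : (Fin d → ℝ) × ℝ) : (F.scaledEigenvalue (expL2 0) p.1 p.2 (h p)).re =
      quarticSymbol p.1 + p.2 * meanQuadratic A p.1 + p.2 ^ 2 * r p :=
    re_scaledEigenvalue hA p.1 p.2 (h p)
  refine ⟨h, r, hh, hr hh, ?_⟩
  have hline : Tendsto (fun ε : ℝ => ((0 : Fin d → ℝ), ε)) (𝓝 ε₀) (𝓝 (0, ε₀)) :=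
    Continuous.tendsto (by fun_prop) _
  filter_upwards [hline.eventually hh.eventually_analyticAt,
    hline.eventually hres.eventually_nhds, hzero] with ε h1 h2 h3
  refine ⟨h1, hr h1, fun ρ hρ hρε => ?_⟩
  have hρ0 : ρ ≠ 0 := by positivity
  have hρε' : ρ ^ 2 * ε = 1 := by rw [← hρε]; field_simp
  obtain ⟨κ, hκ, hco⟩ := hF.exists_coercive
  have hslice : Tendsto (fun η : Fin d → ℝ => (η, ε)) (𝓝 0) (𝓝 (0, ε)) :=
    Continuous.tendsto (by fun_prop) _
  -- The eigenvalue of the branch falls below the threshold `κ` near `η = 0`. How near may depend on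
  -- `ρ`, which is harmless: only germs at `η = 0` matter, and uniformity comes from `ε` alone.
  have hcont : Tendsto (fun η : Fin d → ℝ => ρ ^ 2 *
      (F.scaledEigenvalue (expL2 0) η ε (h (η, ε))).re) (𝓝 0) (𝓝 0) := by
    have h4 := (F.continuousAt_scaledEigenvalue (expL2 0) h1).const_smul (ρ ^ 2)
    have h6 : ρ ^ 2 * (F.scaledEigenvalue (expL2 0) (0 : Fin d → ℝ) ε (h (0, ε))).re = 0 := by
      simp [h3, FormData.scaledEigenvalue]
    have h7 := h4.tendsto.comp hslice
    rwa [Pi.smul_apply, smul_eq_mul, h6] at h7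
  filter_upwards [hslice.eventually h2, hco, hcont.eventually (gt_mem_nhds hκ)] with η h4 h5 h6
  have h7 : (blochData hA).IsEigenvector ρ η
      (ρ ^ 2 * (F.scaledEigenvalue (expL2 0) η ε (h (η, ε))).re)
      (constY d + ((ε : ℂ) • h (η, ε) : meanZero d)) := by
    have h8 := hF.isEigenvector_of_residual hρ0 (η := η) (χ := h (η, ε)) (by
      rw [incl_constY, hρε]; exact h4)
    rw [incl_constY, hρε] at h8
    exact h8
  have h8 := isNormalizedGroundState_iff hA (h5 ρ hρ) h6 h7
  rw [hsE (η, ε)] at h8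
  have h9 : ρ ^ 2 * (quarticSymbol η + ε * meanQuadratic A η + ε ^ 2 * r (η, ε)) =
      ρ ^ 2 * quarticSymbol η + (meanQuadratic A η + ε * r (η, ε)) := by
    linear_combination (meanQuadratic A η + ε * r (η, ε)) * hρε'
  rw [h9] at h8
  exact h8

omit hA in
theorem firstEigenfunction_spec {ρ : ℝ} {η : Fin d → ℝ} {ψ : HY d 2}
    (h : ∀ φ, IsNormalizedGroundState A ρ η φ ↔ φ = ψ) : firstEigenfunction A ρ η = ψ := by
  have hex : ∃ φ, IsNormalizedGroundState A ρ η φ := ⟨ψ, (h ψ).2 rfl⟩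
  rw [firstEigenfunction, dif_pos hex]
  exact (h _).1 hex.choose_spec

omit hA in
theorem analyticAt_quarticSymbol (x : Fin d → ℝ) : AnalyticAt ℝ quarticSymbol x := by
  have : ContDiff ℝ ω (quarticSymbol : (Fin d → ℝ) → ℝ) := by unfold quarticSymbol; fun_prop
  exact this.contDiffAt.analyticAt

omit hA in
theorem analyticAt_meanQuadratic (A : (Fin d → ℝ) → Matrix (Fin d) (Fin d) ℝ) (x : Fin d → ℝ) :
    AnalyticAt ℝ (meanQuadratic A) x := by
  have : ContDiff ℝ ω (meanQuadratic A) := by unfold meanQuadratic; fun_prop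
  exact this.contDiffAt.analyticAt

omit hA in
/-- The embedding of correctors, scaled to the normalized eigenfunction. -/
noncomputable def scaledEmbedding (d : ℕ) (ε : ℝ) : meanZero d →L[ℝ] HY d 2 :=
  (((normConst d * ε : ℝ) : ℂ) • (meanZero d).subtypeL).restrictScalars ℝ

omit hA in
theorem norm_scaledEmbedding {ε : ℝ} (hε : 0 ≤ ε) (x : meanZero d) :
    ‖scaledEmbedding d ε x‖ = normConst d * ε * ‖x‖ := by
  change ‖((normConst d * ε : ℝ) : ℂ) • (x : HY d 2)‖ = _
  rw [norm_smul, Complex.norm_real,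
    Real.norm_of_nonneg (mul_nonneg (normConst_pos d).le hε)]
  rfl

omit hA in
theorem analyticAt_slice {E : Type*} [NormedAddCommGroup E] [NormedSpace ℝ E]
    {f : (Fin d → ℝ) × ℝ → E} {ε : ℝ} (hf : AnalyticAt ℝ f (0, ε)) :
    AnalyticAt ℝ (fun η => f (η, ε)) 0 :=
  AnalyticAt.comp (g := f) (f := fun η => (η, ε)) hf (analyticAt_id.prod analyticAt_const)

/-- Equality of germs at `η = 0`, which is what differentiation there requires. For `ε` near `ε₀`
that are not of the form `ρ⁻²` with `ρ ≥ 1`, the spectral part is vacuous. -/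
theorem exists_eventuallyEq_eigenpair {ε₀ : ℝ} (hε₀ : 0 ≤ ε₀) :
    ∃ (h : (Fin d → ℝ) × ℝ → meanZero d) (r : (Fin d → ℝ) × ℝ → ℝ),
      AnalyticAt ℝ h (0, ε₀) ∧ AnalyticAt ℝ r (0, ε₀) ∧
      ∀ᶠ ε in 𝓝 ε₀, AnalyticAt ℝ h (0, ε) ∧ AnalyticAt ℝ r (0, ε) ∧
        ∀ ρ : ℝ, 1 ≤ ρ → (ρ ^ 2)⁻¹ = ε →
          firstEigenvalue A ρ =ᶠ[𝓝 0] (fun η =>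
            ρ ^ 2 * quarticSymbol η + (meanQuadratic A η + ε * r (η, ε))) ∧
          firstEigenfunction A ρ =ᶠ[𝓝 0] (fun η =>
            (normConst d : ℂ) • constY d + scaledEmbedding d ε (h (η, ε))) ∧
          ∀ᶠ η in 𝓝 (0 : Fin d → ℝ), IsLeast (blochEigenvalues A ρ η) (firstEigenvalue A ρ η) ∧
            (∃! φ, IsNormalizedGroundState A ρ η φ) ∧
            IsNormalizedGroundState A ρ η (firstEigenfunction A ρ η) := by
  obtain ⟨h, r, hh, hr, hev⟩ := exists_analytic_eigenpair hA hε₀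
  refine ⟨h, r, hh, hr, hev.mono fun ε ⟨h1, h2, h3⟩ => ⟨h1, h2, fun ρ hρ hρε => ?_⟩⟩
  have h4 := h3 ρ hρ hρε
  refine ⟨?_, ?_, ?_⟩
  · filter_upwards [h4] with η h5
    exact h5.1.csInf_eq
  · filter_upwards [h4] with η h5
    rw [firstEigenfunction_spec h5.2, smul_add, smul_smul, ← Complex.ofReal_mul]
    rfl
  · filter_upwards [h4] with η h5
    have h6 : firstEigenvalue A ρ η = _ := h5.1.csInf_eq
    have h7 := firstEigenfunction_spec h5.2
    refine ⟨h6 ▸ h5.1, ⟨_, (h5.2 _).2 rfl, fun φ hφ => (h5.2 φ).1 hφ⟩, ?_⟩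
    rw [h7]
    exact (h5.2 _).2 rfl

omit hA in
theorem sobolevNorm_one_le (u : HY d 2) : sobolevNorm 1 (HY.toL2 u) ≤ ‖u‖ := by
  have hle (n : Fin d → ℤ) : sobolevWeight 1 n * ‖fourierY (HY.toL2 u) n‖ ^ 2 ≤
      sobolevWeight 2 n * ‖fourierY (HY.toL2 u) n‖ ^ 2 := by
    gcongr
    have := sum_sq_nonneg n
    unfold sobolevWeight
    exact pow_le_pow_right₀ (by linarith) (by norm_num)
  have hs := (HY.hasSum_norm_sq u).summable
  rw [HY.norm_eq, sobolevNorm, sobolevNorm]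
  refine Real.sqrt_le_sqrt (Summable.tsum_le_tsum hle (hs.of_nonneg_of_le (fun n => ?_) hle) hs)
  exact mul_nonneg (sobolevWeight_pos 1 n).le (sq_nonneg _)

omit hA in
theorem inv_sq_mem_Icc {ρ : ℝ} (hρ : 1 ≤ ρ) : (ρ ^ 2)⁻¹ ∈ Set.Icc (0 : ℝ) 1 :=
  ⟨by positivity, inv_le_one_of_one_le₀ (one_le_pow₀ hρ)⟩

/-- The only term of order one in the eigenfunction is a constant, which any derivative removes; the
rest carries the factor `ε = ρ⁻²`. No distinction by order is needed. -/
theorem eigenfunctionDerivNorm_le {β : Fin d → ℕ} (hβ : ∑ j, β j ≠ 0) :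
    ∃ C : ℝ, ∀ ρ : ℝ, 1 ≤ ρ → eigenfunctionDerivNorm A ρ β ≤ C / ρ ^ 2 := by
  have hl : indexList β ≠ [] := by
    rw [← List.length_pos_iff, length_indexList]
    exact Nat.pos_of_ne_zero hβ
  obtain ⟨C, hC⟩ := exists_uniform_bound
    (P := fun ε C => ∀ ρ : ℝ, 1 ≤ ρ → (ρ ^ 2)⁻¹ = ε → eigenfunctionDerivNorm A ρ β ≤ C / ρ ^ 2)
    -- The endpoint `ε₀ = 0` is not attained by any `ρ`, but it is needed for compactness and
    -- controls the regime `ρ → ∞`.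
    (fun ε a b hab h ρ hρ hρε => (h ρ hρ hρε).trans (by gcongr)) (fun ε₀ hε₀ => by
      obtain ⟨h, r, hh, -, hev⟩ := exists_eventuallyEq_eigenpair hA hε₀.1
      obtain ⟨C, hC⟩ := exists_bound_iterPartial hh (indexList β)
      refine ⟨normConst d * C, ?_⟩
      filter_upwards [hev, hC] with ε h1 h2 ρ hρ hρε
      have h3 := (iterPartial_congr (h1.2.2 ρ hρ hρε).2.1 (indexList β)).self_of_nhds
      rw [iterPartial_const_add _ _ hl, (iterPartial_clm_comp (scaledEmbedding d ε)
        (analyticAt_slice h1.1) (indexList β)).self_of_nhds] at h3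
      rw [eigenfunctionDerivNorm, multiPartial_eq_iterPartial, h3]
      refine (sobolevNorm_one_le _).trans ?_
      have hε : 0 ≤ ε := hρε ▸ (inv_sq_mem_Icc hρ).1
      rw [norm_scaledEmbedding hε, div_eq_mul_inv, hρε, mul_right_comm]
      have := (normConst_pos d).le
      gcongr)
  exact ⟨C, fun ρ hρ => hC _ (inv_sq_mem_Icc hρ) ρ hρ rfl⟩

/-- Up to an error of order `ρ⁻²`, the derivatives of the first Bloch eigenvalue are those of the
sum of the quartic symbol and the effective quadratic form. -/
theorem eigenvalueDeriv_expansion (β : Fin d → ℕ) :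
    ∃ C : ℝ, ∀ ρ : ℝ, 1 ≤ ρ → |eigenvalueDeriv A ρ β -
      (ρ ^ 2 * iterPartial (indexList β) quarticSymbol 0 +
        iterPartial (indexList β) (meanQuadratic A) 0)| ≤ C / ρ ^ 2 := by
  obtain ⟨C, hC⟩ := exists_uniform_bound
    (P := fun ε C => ∀ ρ : ℝ, 1 ≤ ρ → (ρ ^ 2)⁻¹ = ε → |eigenvalueDeriv A ρ β -
      (ρ ^ 2 * iterPartial (indexList β) quarticSymbol 0 +
        iterPartial (indexList β) (meanQuadratic A) 0)| ≤ C / ρ ^ 2)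
    (fun ε a b hab h ρ hρ hρε => (h ρ hρ hρε).trans (by gcongr)) (fun ε₀ hε₀ => by
      obtain ⟨h, r, -, hr, hev⟩ := exists_eventuallyEq_eigenpair hA hε₀.1
      obtain ⟨C, hC⟩ := exists_bound_iterPartial hr (indexList β)
      refine ⟨C, ?_⟩
      filter_upwards [hev, hC] with ε h1 h2 ρ hρ hρε
      have hsm (c : ℝ) {f : (Fin d → ℝ) → ℝ} (hf : AnalyticAt ℝ f 0) :
          AnalyticAt ℝ (fun η => c * f η) 0 ∧ iterPartial (indexList β) (fun η => c * f η) 0 =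
          c * iterPartial (indexList β) f 0 :=
        ⟨analyticAt_const.mul hf, (iterPartial_clm_comp (ContinuousLinearMap.mul ℝ ℝ c) hf
          (indexList β)).self_of_nhds⟩
      have ha := hsm (ρ ^ 2) (analyticAt_quarticSymbol 0)
      have hb := analyticAt_meanQuadratic A 0
      have hc := hsm ε (analyticAt_slice h1.2.1)
      have h3 := (iterPartial_congr (h1.2.2 ρ hρ hρε).1 (indexList β)).self_of_nhds
      have h4 := (iterPartial_add ha.1 (hb.add hc.1) (indexList β)).self_of_nhds
      have h5 := (iterPartial_add hb hc.1 (indexList β)).self_of_nhds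
      have h6 : eigenvalueDeriv A ρ β = ρ ^ 2 * iterPartial (indexList β) quarticSymbol 0 +
          (iterPartial (indexList β) (meanQuadratic A) 0 +
            ε * iterPartial (indexList β) (fun η => r (η, ε)) 0) := by
        rw [eigenvalueDeriv, multiPartial_eq_iterPartial, h3, ← ha.2, ← hc.2]
        refine h4.trans ?_
        rw [Pi.add_apply, h5, Pi.add_apply]
      have hε : 0 ≤ ε := hρε ▸ (inv_sq_mem_Icc hρ).1
      rw [h6, ← add_assoc, add_sub_cancel_left, abs_mul, abs_of_nonneg hε, div_eq_mul_inv, hρε,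
        mul_comm]
      gcongr
      exact h2)
  exact ⟨C, fun ρ hρ => hC _ (inv_sq_mem_Icc hρ) ρ hρ rfl⟩

omit hA in
theorem iterPartial_quarticSymbol {l : List (Fin d)} (hl : l.length ≠ 4) :
    iterPartial l quarticSymbol 0 = 0 := by
  -- Degree 4 homogeneity tested on the single dilation by 2: `2 ^ l.length = 2 ^ 4` forces
  -- `l.length = 4`.
  refine iterPartial_eq_zero_of_dilation (t := 2) (s := 2 ^ 4)
    (Eventually.of_forall fun η => ?_) (fun h => hl ?_)
  · simp only [quarticSymbol, Pi.smul_apply, smul_eq_mul, mul_pow, ← Finset.mul_sum]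
    ring
  · exact pow_right_injective₀ (by norm_num) (by norm_num) h

omit hA in
theorem iterPartial_meanQuadratic {l : List (Fin d)} (hl : l.length ≠ 2) :
    iterPartial l (meanQuadratic A) 0 = 0 := by
  refine iterPartial_eq_zero_of_dilation (t := 2) (s := 2 ^ 2)
    (Eventually.of_forall fun η => ?_) (fun h => hl ?_)
  · simp only [meanQuadratic, Pi.smul_apply, smul_eq_mul, Finset.mul_sum]
    exact Finset.sum_congr rfl fun j _ => Finset.sum_congr rfl fun k _ => by ring
  · exact pow_right_injective₀ (by norm_num) (by norm_num) h

theorem meanY_coef_symm (j k : Fin d) : meanY (fun y => A y j k) = meanY (fun y => A y k j) := by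
  unfold meanY
  congr 1
  refine integral_congr_ae ?_
  filter_upwards [ae_restrict_of_ae hA.symm] with t ht
  exact ht.apply k j

theorem iterPartial_meanQuadratic_pair (j k : Fin d) :
    iterPartial (indexList (unitIndex j + unitIndex k)) (meanQuadratic A) 0 =
      2 * meanY (fun y => A y j k) := by
  rcases indexList_unitIndex_add j k with h | h <;> rw [h, two_mul]
  · exact (iterPartial_pair_quadratic _ j k).trans (by rw [meanY_coef_symm hA k j])
  · exact (iterPartial_pair_quadratic _ k j).trans (by rw [meanY_coef_symm hA k j])

end Eigenvalues

theorem sum_unitIndex (j : Fin d) : ∑ i, unitIndex j i = 1 := by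
  simp [unitIndex]

end BlochWave
end

/-! ### The main theorem. -/

theorem theorem5p4 {d : ℕ} (A : (Fin d → ℝ) → Matrix (Fin d) (Fin d) ℝ)
    (hA : BlochWave.IsPeriodicElliptic A) :
    -- the first Bloch eigenpair is well defined and analytic near the origin
    (∀ ρ : ℝ, 1 ≤ ρ →
      (∀ᶠ η in 𝓝 (0 : Fin d → ℝ),
        IsLeast (BlochWave.blochEigenvalues A ρ η) (BlochWave.firstEigenvalue A ρ η) ∧
        (∃! φ, BlochWave.IsNormalizedGroundState A ρ η φ) ∧
        BlochWave.IsNormalizedGroundState A ρ η (BlochWave.firstEigenfunction A ρ η)) ∧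
      AnalyticAt ℝ (BlochWave.firstEigenvalue A ρ) 0 ∧
      AnalyticAt ℝ (BlochWave.firstEigenfunction A ρ) 0) ∧
    -- first order
    (∀ j : Fin d,
      (∃ C : ℝ, ∀ ρ : ℝ, 1 ≤ ρ →
        BlochWave.eigenfunctionDerivNorm A ρ (BlochWave.unitIndex j) ≤ C / ρ ^ 2) ∧
      (∀ ρ : ℝ, 1 ≤ ρ → BlochWave.eigenvalueDeriv A ρ (BlochWave.unitIndex j) = 0)) ∧
    -- second order
    (∀ j k : Fin d,
      (∃ C : ℝ, ∀ ρ : ℝ, 1 ≤ ρ →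
        BlochWave.eigenfunctionDerivNorm A ρ
          (BlochWave.unitIndex j + BlochWave.unitIndex k) ≤ C / ρ ^ 2) ∧
      (∃ C : ℝ, ∀ ρ : ℝ, 1 ≤ ρ →
        |1 / 2 * BlochWave.eigenvalueDeriv A ρ (BlochWave.unitIndex j + BlochWave.unitIndex k)
          - BlochWave.meanY (fun y => A y j k)| ≤ C / ρ ^ 2)) ∧
    -- third order
    (∀ j k l : Fin d,
      (∃ C : ℝ, ∀ ρ : ℝ, 1 ≤ ρ →
        BlochWave.eigenfunctionDerivNorm A ρ
          (BlochWave.unitIndex j + BlochWave.unitIndex k + BlochWave.unitIndex l) ≤ C / ρ ^ 2) ∧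
      (∀ ρ : ℝ, 1 ≤ ρ → BlochWave.eigenvalueDeriv A ρ
          (BlochWave.unitIndex j + BlochWave.unitIndex k + BlochWave.unitIndex l) = 0)) ∧
    -- eigenfunction, order at least four
    (∀ β : Fin d → ℕ, 4 ≤ ∑ j, β j →
      ∃ C : ℝ, ∀ ρ : ℝ, 1 ≤ ρ → BlochWave.eigenfunctionDerivNorm A ρ β ≤ C) ∧
    -- eigenvalue, order four
    (∀ β : Fin d → ℕ, ∑ j, β j = 4 →
      ∃ C : ℝ, ∀ ρ : ℝ, 1 ≤ ρ → |BlochWave.eigenvalueDeriv A ρ β| ≤ C * ρ ^ 2) ∧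
    -- eigenvalue, order greater than four
    (∀ β : Fin d → ℕ, 4 < ∑ j, β j →
      ∃ C : ℝ, ∀ ρ : ℝ, 1 ≤ ρ → |BlochWave.eigenvalueDeriv A ρ β| ≤ C) := by
  have h2 (j k : Fin d) : ∑ i, (BlochWave.unitIndex j + BlochWave.unitIndex k) i = 2 := by
    simp only [Pi.add_apply, Finset.sum_add_distrib, BlochWave.sum_unitIndex]
  have h3 (j k l : Fin d) :
      ∑ i, (BlochWave.unitIndex j + BlochWave.unitIndex k + BlochWave.unitIndex l) i = 3 := by
    simp only [Pi.add_apply, Finset.sum_add_distrib, BlochWave.sum_unitIndex]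
  refine ⟨fun ρ hρ => ?_, fun j => ⟨?_, fun ρ _ => ?_⟩, fun j k => ⟨?_, ?_⟩,
    fun j k l => ⟨?_, fun ρ _ => ?_⟩, fun β hβ => ?_, fun β hβ => ?_, fun β hβ => ?_⟩
  · obtain ⟨h, r, hh, hr, hev⟩ := BlochWave.exists_eventuallyEq_eigenpair hA
      (BlochWave.inv_sq_mem_Icc hρ).1
    obtain ⟨h4, h5, h6⟩ := hev.self_of_nhds.2.2 ρ hρ rfl
    refine ⟨h6, ?_, ?_⟩
    · refine AnalyticAt.congr ?_ h4.symm
      exact (analyticAt_const.mul (BlochWave.analyticAt_quarticSymbol 0)).add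
        ((BlochWave.analyticAt_meanQuadratic A 0).add
          (analyticAt_const.mul (BlochWave.analyticAt_slice hr)))
    · refine AnalyticAt.congr ?_ h5.symm
      exact analyticAt_const.add (((BlochWave.scaledEmbedding d _).analyticAt _).comp
        (BlochWave.analyticAt_slice hh))
  · exact BlochWave.eigenfunctionDerivNorm_le hA (by simp [BlochWave.sum_unitIndex])
  · exact BlochWave.eigenvalueDeriv_eq_zero_of_odd hA ρ (by simp [BlochWave.sum_unitIndex])
  · exact BlochWave.eigenfunctionDerivNorm_le hA (by rw [h2]; norm_num)
  · obtain ⟨C, hC⟩ := BlochWave.eigenvalueDeriv_expansion hA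
      (BlochWave.unitIndex j + BlochWave.unitIndex k)
    -- At order two the quartic symbol drops out and the quadratic form contributes twice the mean
    -- of `A y j k`, which the factor `1 / 2` undoes.
    refine ⟨C / 2, fun ρ hρ => ?_⟩
    have h := hC ρ hρ
    rw [BlochWave.iterPartial_quarticSymbol (by rw [BlochWave.length_indexList, h2]; norm_num),
      BlochWave.iterPartial_meanQuadratic_pair hA, mul_zero, zero_add] at h
    have h' : ∀ x m : ℝ, 1 / 2 * x - m = (x - 2 * m) / 2 := fun x m => by ring
    rw [h', abs_div, abs_two, div_right_comm]
    gcongr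
  · exact BlochWave.eigenfunctionDerivNorm_le hA (by rw [h3]; norm_num)
  · exact BlochWave.eigenvalueDeriv_eq_zero_of_odd hA ρ (by rw [h3]; decide)
  · obtain ⟨C, hC⟩ := BlochWave.eigenfunctionDerivNorm_le hA (β := β) (by omega)
    refine ⟨|C|, fun ρ hρ => (hC ρ hρ).trans ((div_le_div_of_nonneg_right (le_abs_self C)
      (sq_nonneg ρ)).trans (div_le_self (abs_nonneg C) (one_le_pow₀ hρ)))⟩
  · obtain ⟨C, hC⟩ := BlochWave.eigenvalueDeriv_expansion hA β
    -- At order four the quadratic form drops out, and the derivative `a` of the quartic symbol is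
    -- the sole source of growth in `ρ`.
    set a := BlochWave.iterPartial (BlochWave.indexList β) BlochWave.quarticSymbol 0
    refine ⟨|a| + |C|, fun ρ hρ => ?_⟩
    have h := hC ρ hρ
    rw [BlochWave.iterPartial_meanQuadratic (by rw [BlochWave.length_indexList, hβ]; norm_num),
      add_zero] at h
    have hρ2 : 1 ≤ ρ ^ 2 := one_le_pow₀ hρ
    have h4 : C / ρ ^ 2 ≤ |C| * ρ ^ 2 := (div_le_div_of_nonneg_right (le_abs_self C)
      (sq_nonneg ρ)).trans ((div_le_self (abs_nonneg C) hρ2).trans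
        (le_mul_of_one_le_right (abs_nonneg C) hρ2))
    have h5 := abs_sub_abs_le_abs_sub (BlochWave.eigenvalueDeriv A ρ β) (ρ ^ 2 * a)
    rw [abs_mul, abs_of_nonneg (sq_nonneg ρ)] at h5
    linarith
  · obtain ⟨C, hC⟩ := BlochWave.eigenvalueDeriv_expansion hA β
    refine ⟨|C|, fun ρ hρ => ?_⟩
    have h := hC ρ hρ
    rw [BlochWave.iterPartial_quarticSymbol (by rw [BlochWave.length_indexList]; omega),
      BlochWave.iterPartial_meanQuadratic (by rw [BlochWave.length_indexList]; omega),
      mul_zero, add_zero, sub_zero] at h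
    exact h.trans ((div_le_div_of_nonneg_right (le_abs_self C)
      (sq_nonneg ρ)).trans (div_le_self (abs_nonneg C) (one_le_pow₀ hρ)))
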